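/- Let $p\ge 2$ be a real constant. For $x\in\mathbb Z^n$ let $F_p(x)=\sum_{v} f_v^{\,p}$, where $v$ ranges over the distinct values occurring among the coordinates of $x$ (the value $0$ included) and $f_v=|\{i : x_i=v\}|$. The vector $x$ is initially zero and is given by a turnstile stream of at most $m$ updates $(i,c)$, performing $x_i\leftarrow x_i+c$ with $i\in[n]$, $c\in\mathbb Z$, $|c|\le M$ (in the standard setting $m,M\le \mathrm{poly}(n)$). A linear sketch consists of a random integer matrix $S$ with $n$ columns, whose distribution does not depend on $x$, and a function $g_S$; one maintains $Sx$ under the updates, and answers a query by $g_S(Sx)$. Its size is the total number of bits stored, including an implicit description of $S$ and the work space. Updates are handled by a word RAM program with unit-cost instructions on words of $O(L)$ bits, where $L=\log\frac{(n+2)(m+2)(M+2)}{\gamma\delta}$; the update time is the worst-case number of its steps per update. Then there are a word RAM program, depending only on $p$, and constants $C,k$, depending only on $p$, such that for all $n,m,M\in\mathbb N$ and $\gamma,\delta\in(0,1)$ there is a linear sketch with word length at most $C\,L$ and of size at most $C\,L^{k}\,\gamma^{-2/(p-1)}$ that is maintained by this program in time at most $C\,L^{k}\,\gamma^{-2/(p-1)}$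 per update (that is, size and update time are $\tilde O(\gamma^{-2/(p-1)})$), and such that, for every fixed such stream with final vector $x$, with probability at least $1-\delta$ over $S$, $$\bigl|\,g_S(Sx)-(n^p-F_p(x))\,\bigr|\le \gamma^{1/(p-1)}\,\bigl(n^p-F_p(x)\bigr).$$ -/

import Mathlib

/-! ### A word RAM with a step count -/

namespace WordRAM

/-- Arithmetic and comparison instructions on machine words. -/
inductive Op where
  | add | sub | mul | div | mod | lt | eq

/-- The value of an instruction on `w`-bit words (arithmetic modulo `2 ^ w`, unsigned division,
remainder and comparison; a comparison returns the word `1` or `0`). -/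
def Op.eval {w : ℕ} : Op → BitVec w → BitVec w → BitVec w
  | .add, a, b => a + b
  | .sub, a, b => a - b
  | .mul, a, b => a * b
  | .div, a, b => BitVec.udiv a b
  | .mod, a, b => BitVec.umod a b
  | .lt, a, b => if a.toNat < b.toNat then 1 else 0
  | .eq, a, b => if a = b then 1 else 0

/-- Structured word RAM programs. The natural numbers are addresses, except for the literal `k`
in `const d k`. -/
inductive Prog where
  /-- do nothing -/
  | skip
  /-- `mem[d] := k` -/
  | const (d k : ℕ)
  /-- `mem[d] := o mem[a] mem[b]` -/
  | op (o : Op) (d a b : ℕ)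
  /-- `mem[d] := mem[mem[a]]` -/
  | load (d a : ℕ)
  /-- `mem[mem[a]] := mem[b]` -/
  | store (a b : ℕ)
  /-- first `P`, then `Q` -/
  | seq (P Q : Prog)
  /-- if `mem[a] ≠ 0` then `P` else `Q` -/
  | cond (a : ℕ) (P Q : Prog)
  /-- while `mem[a] ≠ 0` do `P` -/
  | loop (a : ℕ) (P : Prog)

/-- The contents of a memory of `s` words of `w` bits each. -/
abbrev Mem (s w : ℕ) : Type := Fin s → BitVec w

/-- `Run P m t m'`: started on memory `m`, the program `P` halts after exactly `t` steps with
memory `m'`. Each instruction and each test costs one step; a program that accesses an address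
outside of the memory gets stuck and has no run. -/
inductive Run {s w : ℕ} : Prog → Mem s w → ℕ → Mem s w → Prop where
  | skip (m : Mem s w) : Run .skip m 1 m
  | const (m : Mem s w) {d : ℕ} (k : ℕ) (hd : d < s) :
      Run (.const d k) m 1 (Function.update m ⟨d, hd⟩ (BitVec.ofNat w k))
  | op (m : Mem s w) (o : Op) {d a b : ℕ} (hd : d < s) (ha : a < s) (hb : b < s) :
      Run (.op o d a b) m 1 (Function.update m ⟨d, hd⟩ (o.eval (m ⟨a, ha⟩) (m ⟨b, hb⟩)))
  | load (m : Mem s w) {d a : ℕ} (hd : d < s) (ha : a < s) (h : (m ⟨a, ha⟩).toNat < s) :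
      Run (.load d a) m 1 (Function.update m ⟨d, hd⟩ (m ⟨(m ⟨a, ha⟩).toNat, h⟩))
  | store (m : Mem s w) {a b : ℕ} (ha : a < s) (hb : b < s) (h : (m ⟨a, ha⟩).toNat < s) :
      Run (.store a b) m 1 (Function.update m ⟨(m ⟨a, ha⟩).toNat, h⟩ (m ⟨b, hb⟩))
  | seq {P Q : Prog} {m m₁ m₂ : Mem s w} {t₁ t₂ : ℕ} :
      Run P m t₁ m₁ → Run Q m₁ t₂ m₂ → Run (.seq P Q) m (t₁ + t₂) m₂
  | cond_true {P Q : Prog} {m m₁ : Mem s w} {a t : ℕ} (ha : a < s) (h : m ⟨a, ha⟩ ≠ 0) :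
      Run P m t m₁ → Run (.cond a P Q) m (1 + t) m₁
  | cond_false {P Q : Prog} {m m₁ : Mem s w} {a t : ℕ} (ha : a < s) (h : m ⟨a, ha⟩ = 0) :
      Run Q m t m₁ → Run (.cond a P Q) m (1 + t) m₁
  | loop_stop {P : Prog} {m : Mem s w} {a : ℕ} (ha : a < s) (h : m ⟨a, ha⟩ = 0) :
      Run (.loop a P) m 1 m
  | loop_step {P : Prog} {m m₁ m₂ : Mem s w} {a t₁ t₂ : ℕ} (ha : a < s) (h : m ⟨a, ha⟩ ≠ 0) :
      Run P m t₁ m₁ → Run (.loop a P) m₁ t₂ m₂ → Run (.loop a P) m (1 + t₁ + t₂) m₂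

/-- Programs are deterministic: the running time and the final memory are determined by the
program and the memory it is started on. -/
theorem Run.unique {s w : ℕ} {P : Prog} {m m₁ m₂ : Mem s w} {t₁ t₂ : ℕ}
    (h₁ : Run P m t₁ m₁) (h₂ : Run P m t₂ m₂) : t₁ = t₂ ∧ m₁ = m₂ := by
  induction h₁ generalizing t₂ m₂ with
  | skip => cases h₂; exact ⟨rfl, rfl⟩
  | const => cases h₂; exact ⟨rfl, rfl⟩
  | op => cases h₂; exact ⟨rfl, rfl⟩
  | load => cases h₂; exact ⟨rfl, rfl⟩
  | store => cases h₂; exact ⟨rfl, rfl⟩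
  | seq _ _ ih₁ ih₂ =>
    cases h₂ with
    | seq p q =>
      obtain ⟨rfl, rfl⟩ := ih₁ p
      obtain ⟨rfl, rfl⟩ := ih₂ q
      exact ⟨rfl, rfl⟩
  | cond_true ha h _ ih =>
    cases h₂ with
    | cond_true _ _ p => obtain ⟨rfl, rfl⟩ := ih p; exact ⟨rfl, rfl⟩
    | cond_false _ h' p => exact absurd h' h
  | cond_false ha h _ ih =>
    cases h₂ with
    | cond_true _ h' p => exact absurd h h'
    | cond_false _ _ p => obtain ⟨rfl, rfl⟩ := ih p; exact ⟨rfl, rfl⟩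
  | loop_stop ha h =>
    cases h₂ with
    | loop_stop => exact ⟨rfl, rfl⟩
    | loop_step _ h' => exact absurd h h'
  | loop_step ha h _ _ ih₁ ih₂ =>
    cases h₂ with
    | loop_stop _ h' => exact absurd h' h
    | loop_step _ _ p q =>
      obtain ⟨rfl, rfl⟩ := ih₁ p
      obtain ⟨rfl, rfl⟩ := ih₂ q
      exact ⟨rfl, rfl⟩

end WordRAM

/-! ### Turnstile streams and frequency moments -/

namespace Turnstile

open WordRAM

/-- The vector that results from a stream of updates `x i ← x i + c`, started from the zero
vector. -/
def result {n : ℕ} (u : List (Fin n × ℤ)) : Fin n → ℤ :=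
  (u.map fun e => Pi.single e.1 e.2).sum

/-- Streams of at most `m` updates, each by at most `M` in absolute value. -/
def Valid {n : ℕ} (m M : ℕ) (u : List (Fin n × ℤ)) : Prop :=
  u.length ≤ m ∧ ∀ e ∈ u, |e.2| ≤ (M : ℤ)

/-- The frequency moment `F_p = ∑_v f_v ^ p`; the sum is over the distinct values `v` occurring
in `x` (the value `0` included), and `f_v` is the number of coordinates equal to `v`. -/
noncomputable def freqMoment {n : ℕ} (p : ℝ) (x : Fin n → ℤ) : ℝ :=
  ∑ v ∈ Finset.univ.image x, ((Finset.univ.filter fun i => x i = v).card : ℝ) ^ p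

/-- Present the update `(i, c)` to the machine: the index is written into word `0` and the
increment (in two's complement) into word `1`. -/
def present {n s w : ℕ} (m : Mem s w) (e : Fin n × ℤ) : Mem s w := fun a =>
  if a.val = 0 then BitVec.ofNat w e.1.val
  else if a.val = 1 then BitVec.ofInt w e.2
  else m a

/-- `Processes P T m u m'`: handling the updates of the stream `u` one after the other with the
program `P`, at most `T` steps for each of them, turns memory `m` into memory `m'`. -/
inductive Processes {n s w : ℕ} (P : Prog) (T : ℕ) :
    Mem s w → List (Fin n × ℤ) → Mem s w → Prop where
  | nil (m : Mem s w) : Processes P T m [] m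
  | cons {m m₁ m₂ : Mem s w} {e : Fin n × ℤ} {u : List (Fin n × ℤ)} {t : ℕ} :
      Run P (present m e) t m₁ → t ≤ T → Processes P T m₁ u m₂ → Processes P T m (e :: u) m₂

/-- The data of a linear sketch for integer vectors of length `n`, kept in a memory of `words`
words of `wordBits` bits each. Everything that is needed to handle updates and queries (the
sketch `S x`, the description of the random matrix `S`, and work space) is in this memory. -/
structure LinearSketch (n : ℕ) where
  /-- sketching dimension -/
  dim : ℕ
  /-- number of memory words -/
  words : ℕ
  /-- word length in bits -/
  wordBits : ℕ
  /-- the distribution of the memory contents before the stream -/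
  start : PMF (Mem words wordBits)
  /-- the sketching matrix `S` that the memory contents describe -/
  mat : Mem words wordBits → Matrix (Fin dim) (Fin n) ℤ
  /-- the words that hold the coordinates of `S x` -/
  cell : Fin dim ↪ Fin words
  /-- the answer `g_S (S x)` to a query, a function of `S` and `S x` -/
  answer : Matrix (Fin dim) (Fin n) ℤ → (Fin dim → ℤ) → ℝ

/-- The total size in bits of the memory of the sketch. -/
def LinearSketch.size {n : ℕ} (A : LinearSketch n) : ℕ := A.words * A.wordBits

/-- The program `P` maintains the sketch with update time `T` on all streams of at most `m`
updates by at most `M`: whichever matrix `S` has been drawn, after the stream the memory still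
describes `S`, and it holds `S x` (in two's complement) for the current vector `x`. -/
def LinearSketch.MaintainedBy {n : ℕ} (A : LinearSketch n) (P : Prog) (T m M : ℕ) : Prop :=
  ∀ μ₀ ∈ A.start.support, ∀ u : List (Fin n × ℤ), Valid m M u →
    ∃ μ₁, Processes P T μ₀ u μ₁ ∧ A.mat μ₁ = A.mat μ₀ ∧
      ∀ l, (μ₁ (A.cell l)).toInt = (A.mat μ₀).mulVec (result u) l

/-- With probability at least `1 - δ` over the draw of the matrix `S` (which does not depend on
`x`), the answer to a query is within a factor `1 ± ε` of the value `f`. -/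
def LinearSketch.Approximates {n : ℕ} (A : LinearSketch n) (x : Fin n → ℤ) (f ε δ : ℝ) : Prop :=
  ENNReal.ofReal (1 - δ) ≤
    A.start.toOuterMeasure {μ | |A.answer (A.mat μ) ((A.mat μ).mulVec x) - f| ≤ ε * f}

end Turnstile

/-! Subtracting a reference value `v` from all coordinates does not change `F_p`. Let `g` be the
number of coordinates different from `v`, and `f` the largest frequency. Since `n^p - F_p ≥ n^(p-1)
(n - f)` (`le_pow_sub_freqMoment`), an additive error `O(ε) n^(p-1) (n - f)` is good enough for
relative error `ε = γ^(1/(p-1))`. A uniformly random coordinate supplies `v`: for all but a fraction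
1/32 of the choices, `g ≤ 32 (n - f)` (`card_bad_reference_le`).

Given `v`, sample the coordinates at rate `c` and rescale the frequencies of the nonzero values of
`x - v`. If the vector of sampled frequencies is within `θ c g` of its mean in Euclidean norm, the
estimate is off by `O(θ) n^(p-1) g` (`abs_estimate_sub_le`). Pairwise independent hashing achieves
this by Chebyshev's inequality once the expected sample size is about `1/θ^2`, up to logarithms
(`sum_deviation_le`, `card_not_representative_le`). With `θ` proportional to `ε`, this is the source
of `γ^(-2/(p-1))`.

As `g` is unknown, nested samples at rates about `2^(-j)` are kept. Each stores `32 τ` power sums of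
its coordinates, with coefficients reduced modulo a prime `q > n`; by a Vandermonde determinant
these determine any `16 τ`-sparse vector (`decode_mulVec`). The sparsest level showing at least `τ`
nonzero coordinates is used (`exists_level`, `abs_copyAnswer_sub_le`). One more block isolates the
reference coordinate. At most 1/16 of the seeds of a copy are bad, so the median of `ℓ` independent
copies fails with probability at most `2^(-ℓ)` (`card_majority_bad_le`).

On the machine, a row is three parameter words and one counter, and its coefficient comes from a
running power of `i + 1`, so an update takes a constant number of steps per row. Counters wrap
modulo `2^w`, which is harmless because the final value fits into a word. Answers are arbitrary
functions of `S` and `S x`, so decoding may use choice. -/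

namespace TurnstileSketch

open WordRAM Turnstile

/-! ### The update program and the execution of one row. -/

/-- The loop body: process one row of the sketch. -/
def rowProgram : Prog :=
  .seq (.load 9 6) <| .seq (.op .mul 9 9 0) <| .seq (.op .add 6 6 4) <|
  .seq (.load 10 6) <| .seq (.op .add 9 9 10) <| .seq (.op .mod 9 9 2) <|
  .seq (.op .add 6 6 4) <| .seq (.load 10 6) <| .seq (.op .lt 9 9 10) <|
  .seq (.op .mul 9 9 5) <| .seq (.op .mul 9 9 1) <| .seq (.op .add 6 6 4) <|
  .seq (.load 10 6) <| .seq (.op .add 9 9 10) <| .seq (.store 6 9) <|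
  .seq (.op .add 6 6 4) <| .seq (.op .mul 5 5 7) <| .seq (.op .mod 5 5 2) <| .op .sub 8 8 4

/-- The update program: loop over all rows of the sketch, keeping a running power of `i + 1`. -/
def updateProgram : Prog :=
  .seq (.const 4 1) <| .seq (.const 5 1) <| .seq (.const 6 16) <| .seq (.op .add 7 0 4) <|
  .seq (.op .mul 8 3 4) <| .loop 8 rowProgram

/-- The word at address `a`, or `0` outside of the memory. -/
def rd {s w : ℕ} (m : Mem s w) (a : ℕ) : BitVec w := if h : a < s then m ⟨a, h⟩ else 0

/-- Overwrite the word at address `a`. -/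
def wr {s w : ℕ} (m : Mem s w) (a : ℕ) (v : BitVec w) : Mem s w :=
  fun b => if b.val = a then v else m b

theorem rd_wr {s w : ℕ} (m : Mem s w) {a : ℕ} (b : ℕ) (v : BitVec w) (ha : a < s) :
    rd (wr m a v) b = if b = a then v else rd m b := by
  unfold rd wr
  by_cases hb : b = a
  · subst hb; simp [ha]
  · simp [hb]

theorem update_eq_wr {s w : ℕ} (m : Mem s w) {a : ℕ} (h : a < s) (v : BitVec w) :
    Function.update m ⟨a, h⟩ v = wr m a v := by
  funext b
  unfold wr
  by_cases hb : b.val = a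
  · subst hb; simp
  · have : b ≠ ⟨a, h⟩ := fun e => hb (by rw [e])
    simp [hb, this]

theorem run_const {s w : ℕ} (m : Mem s w) {d : ℕ} (k : ℕ) (hd : d < s) :
    Run (.const d k) m 1 (wr m d (BitVec.ofNat w k)) :=
  update_eq_wr m hd _ ▸ Run.const m k hd

theorem run_op {s w : ℕ} (m : Mem s w) (o : Op) {d a b : ℕ} (hd : d < s) (ha : a < s)
    (hb : b < s) : Run (.op o d a b) m 1 (wr m d (o.eval (rd m a) (rd m b))) := by
  have := Run.op m o hd ha hb
  rw [update_eq_wr] at this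
  simpa [rd, ha, hb] using this

theorem run_load {s w : ℕ} (m : Mem s w) {d a : ℕ} (c : ℕ) (hd : d < s) (ha : a < s)
    (hc : c < s) (h : (rd m a).toNat = c) : Run (.load d a) m 1 (wr m d (rd m c)) := by
  subst h
  have e : m ⟨a, ha⟩ = rd m a := by simp [rd, ha]
  have := Run.load m hd ha (by rw [e]; exact hc)
  rw [update_eq_wr] at this
  rw [rd, dif_pos hc]
  convert this using 4
  rw [e]

theorem run_store {s w : ℕ} (m : Mem s w) {a b : ℕ} (c : ℕ) (ha : a < s) (hb : b < s)
    (hc : c < s) (h : (rd m a).toNat = c) : Run (.store a b) m 1 (wr m c (rd m b)) := by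
  subst h
  have e : m ⟨a, ha⟩ = rd m a := by simp [rd, ha]
  have := Run.store m ha hb (by rw [e]; exact hc)
  rw [update_eq_wr] at this
  simpa [rd, ha, hb] using this

/-- `Reaches Q m t Φ`: from `m`, the program `Q` runs for `t` steps and then `Φ` holds. -/
def Reaches {s w : ℕ} (Q : Prog) (m : Mem s w) (t : ℕ) (Φ : Mem s w → Prop) : Prop :=
  ∃ m', Run Q m t m' ∧ Φ m'

theorem reaches_seq {s w : ℕ} {P Q : Prog} {m m₁ : Mem s w} {t : ℕ} {Φ : Mem s w → Prop}
    (h : Run P m 1 m₁) (hQ : Reaches Q m₁ t Φ) : Reaches (.seq P Q) m (t + 1) Φ := by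
  obtain ⟨m', h', hΦ⟩ := hQ
  exact ⟨m', by rw [add_comm]; exact Run.seq h h', hΦ⟩

/-- The continuation sees the new memory only through its `rd` equation. A program is then verified
by rewriting along these equations, and no nested `wr` terms build up. -/
theorem reaches_const {s w : ℕ} {Q : Prog} (m : Mem s w) {d k t : ℕ} {Φ : Mem s w → Prop}
    (hd : d < s) (hQ : ∀ m₁ : Mem s w,
      (∀ x, rd m₁ x = if x = d then BitVec.ofNat w k else rd m x) → Reaches Q m₁ t Φ) :
    Reaches (.seq (.const d k) Q) m (t + 1) Φ :=
  reaches_seq (run_const m k hd) (hQ _ fun _ => rd_wr m _ _ hd)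

theorem reaches_op {s w : ℕ} {Q : Prog} (m : Mem s w) {o : Op} {d a b t : ℕ}
    {Φ : Mem s w → Prop} (hd : d < s) (ha : a < s) (hb : b < s) (hQ : ∀ m₁ : Mem s w,
      (∀ x, rd m₁ x = if x = d then o.eval (rd m a) (rd m b) else rd m x) → Reaches Q m₁ t Φ) :
    Reaches (.seq (.op o d a b) Q) m (t + 1) Φ :=
  reaches_seq (run_op m o hd ha hb) (hQ _ fun _ => rd_wr m _ _ hd)

theorem reaches_last {s w : ℕ} (m : Mem s w) {o : Op} {d a b : ℕ}
    {Φ : Mem s w → Prop} (hd : d < s) (ha : a < s) (hb : b < s) (hQ : ∀ m₁ : Mem s w,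
      (∀ x, rd m₁ x = if x = d then o.eval (rd m a) (rd m b) else rd m x) → Φ m₁) :
    Reaches (.op o d a b) m 1 Φ :=
  ⟨_, run_op m o hd ha hb, hQ _ fun _ => rd_wr m _ _ hd⟩

theorem reaches_load {s w : ℕ} {Q : Prog} (m : Mem s w) {d a t : ℕ} (c : ℕ)
    {Φ : Mem s w → Prop} (hd : d < s) (ha : a < s) (hc : c < s) (h : (rd m a).toNat = c)
    (hQ : ∀ m₁ : Mem s w, (∀ x, rd m₁ x = if x = d then rd m c else rd m x) → Reaches Q m₁ t Φ) :
    Reaches (.seq (.load d a) Q) m (t + 1) Φ :=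
  reaches_seq (run_load m c hd ha hc h) (hQ _ fun _ => rd_wr m _ _ hd)

theorem reaches_store {s w : ℕ} {Q : Prog} (m : Mem s w) {a b t : ℕ} (c : ℕ)
    {Φ : Mem s w → Prop} (ha : a < s) (hb : b < s) (hc : c < s) (h : (rd m a).toNat = c)
    (hQ : ∀ m₁ : Mem s w, (∀ x, rd m₁ x = if x = c then rd m b else rd m x) → Reaches Q m₁ t Φ) :
    Reaches (.seq (.store a b) Q) m (t + 1) Φ :=
  reaches_seq (run_store m c ha hb hc h) (hQ _ fun _ => rd_wr m _ _ hc)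

/-- Words `c`, `c + 1`, `c + 2` hold the row parameters and `c + 3` its counter. Among the
registers, 4 is the constant 1, 5 the running power, 6 the pointer, 7 the base `i + 1`, 8 the number
of rows left; 9 and 10 are scratch. -/
theorem run_row {s w : ℕ} (m : Mem s w) (c : ℕ) (hc : 16 ≤ c) (hcs : c + 4 ≤ s)
    (hw : s < 2 ^ w) (h4 : rd m 4 = BitVec.ofNat w 1) (h6 : rd m 6 = BitVec.ofNat w c) :
    Reaches rowProgram m 19 fun m' => (∀ a, a < 5 ∨ a = 7 → rd m' a = rd m a) ∧
      rd m' 5 = BitVec.umod (rd m 5 * rd m 7) (rd m 2) ∧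
      rd m' 6 = BitVec.ofNat w (c + 4) ∧ rd m' 8 = rd m 8 - BitVec.ofNat w 1 ∧
      rd m' (c + 3) =
        rd m (c + 3) + (if (BitVec.umod (rd m c * rd m 0 + rd m (c + 1)) (rd m 2)).toNat
          < (rd m (c + 2)).toNat then 1 else 0) * rd m 5 * rd m 1 ∧
      ∀ a, 16 ≤ a → a ≠ c + 3 → rd m' a = rd m a := by
  have hnat : ∀ k, k ≤ c + 4 → (BitVec.ofNat w k).toNat = k := fun k hk => by
    rw [BitVec.toNat_ofNat, Nat.mod_eq_of_lt (by omega)]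
  have n6 : ∀ k, c + k ≠ 6 := fun k => by omega
  have n9 : ∀ k, c + k ≠ 9 := fun k => by omega
  have n10 : ∀ k, c + k ≠ 10 := fun k => by omega
  unfold rowProgram
  refine reaches_load m c (by omega) (by omega) (by omega) (by rw [h6, hnat _ (by omega)])
    fun m1 e1 => ?_
  refine reaches_op m1 (by omega) (by omega) (by omega) fun m2 e2 => ?_
  refine reaches_op m2 (by omega) (by omega) (by omega) fun m3 e3 => ?_
  have p3 : rd m3 6 = BitVec.ofNat w (c + 1) := by
    simp [e3, e2, e1, Op.eval, h4, h6, BitVec.ofNat_add]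
  refine reaches_load m3 (c + 1) (by omega) (by omega) (by omega) (by rw [p3, hnat _ (by omega)])
    fun m4 e4 => ?_
  refine reaches_op m4 (by omega) (by omega) (by omega) fun m5 e5 => ?_
  refine reaches_op m5 (by omega) (by omega) (by omega) fun m6 e6 => ?_
  refine reaches_op m6 (by omega) (by omega) (by omega) fun m7 e7 => ?_
  have p7 : rd m7 6 = BitVec.ofNat w (c + 2) := by
    have : rd m7 6 = rd m3 6 + BitVec.ofNat w 1 := by
      simp [e7, e6, e5, e4, e3, e2, e1, Op.eval, h4]
    rw [this, p3, ← BitVec.ofNat_add]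
  refine reaches_load m7 (c + 2) (by omega) (by omega) (by omega) (by rw [p7, hnat _ (by omega)])
    fun m8 e8 => ?_
  refine reaches_op m8 (by omega) (by omega) (by omega) fun m9 e9 => ?_
  refine reaches_op m9 (by omega) (by omega) (by omega) fun m10 e10 => ?_
  refine reaches_op m10 (by omega) (by omega) (by omega) fun m11 e11 => ?_
  refine reaches_op m11 (by omega) (by omega) (by omega) fun m12 e12 => ?_
  have p12 : rd m12 6 = BitVec.ofNat w (c + 3) := by
    have : rd m12 6 = rd m7 6 + BitVec.ofNat w 1 := by
      simp [e12, e11, e10, e9, e8, e7, e6, e5, e4, e3, e2, e1, Op.eval, h4]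
    rw [this, p7, ← BitVec.ofNat_add]
  refine reaches_load m12 (c + 3) (by omega) (by omega) (by omega)
    (by rw [p12, hnat _ (by omega)]) fun m13 e13 => ?_
  refine reaches_op m13 (by omega) (by omega) (by omega) fun m14 e14 => ?_
  have p14 : rd m14 6 = BitVec.ofNat w (c + 3) := by simp [e14, e13, p12]
  refine reaches_store m14 (c + 3) (by omega) (by omega) (by omega)
    (by rw [p14, hnat _ (by omega)]) fun m15 e15 => ?_
  refine reaches_op m15 (by omega) (by omega) (by omega) fun m16 e16 => ?_
  refine reaches_op m16 (by omega) (by omega) (by omega) fun m17 e17 => ?_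
  refine reaches_op m17 (by omega) (by omega) (by omega) fun m18 e18 => ?_
  refine reaches_last m18 (by omega) (by omega) (by omega) fun m19 e19 => ?_
  have far : ∀ a, 11 ≤ a → a ≠ c + 3 → rd m19 a = rd m a := fun a ha hac => by
    have a5 : a ≠ 5 := by omega
    have a6 : a ≠ 6 := by omega
    have a8 : a ≠ 8 := by omega
    have a9 : a ≠ 9 := by omega
    have a10 : a ≠ 10 := by omega
    simp [e19, e18, e17, e16, e15, e14, e13, e12, e11, e10, e9, e8, e7, e6, e5, e4, e3, e2, e1,
      a5, a6, a8, a9, a10, hac]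
  have k0 : ∀ k, k < 11 → k ≠ c + 3 := fun k hk => by omega
  have c5 : ∀ k, c + k ≠ 5 := fun k => by omega
  have c8 : ∀ k, c + k ≠ 8 := fun k => by omega
  have near : ∀ a, a < 5 ∨ a = 7 → rd m19 a = rd m a := fun a ha => by
    have a5 : a ≠ 5 := by omega
    have a6 : a ≠ 6 := by omega
    have a8 : a ≠ 8 := by omega
    have a9 : a ≠ 9 := by omega
    have a10 : a ≠ 10 := by omega
    have hac : a ≠ c + 3 := by omega
    simp [e19, e18, e17, e16, e15, e14, e13, e12, e11, e10, e9, e8, e7, e6, e5, e4, e3, e2, e1,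
      a5, a6, a8, a9, a10, hac]
  have p14v : rd m14 9 = rd m (c + 3) + (if (BitVec.umod (rd m c * rd m 0 + rd m (c + 1))
      (rd m 2)).toNat < (rd m (c + 2)).toNat then 1 else 0) * rd m 5 * rd m 1 := by
    simp [e14, e13, e12, e11, e10, e9, e8, e7, e6, e5, e4, e3, e2, e1, Op.eval, n6, n9, n10,
      BitVec.add_comm]
  refine ⟨near, ?_, ?_, ?_, ?_, fun a ha hac => far a (by omega) hac⟩
  · have h15 : rd m15 5 = rd m 5 ∧ rd m15 7 = rd m 7 ∧ rd m15 2 = rd m 2 := by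
      simp [e15, e14, e13, e12, e11, e10, e9, e8, e7, e6, e5, e4, e3, e2, e1, k0]
    simp [e19, e18, e17, e16, h15, Op.eval]
  · have : rd m19 6 = rd m14 6 + BitVec.ofNat w 1 := by
      simp [e19, e18, e17, e16, e15, e14, e13, e12, e11, e10, e9, e8, e7, e6, e5, e4, e3, e2, e1,
        k0, Op.eval, h4]
    rw [this, p14, ← BitVec.ofNat_add]
  · simp [e19, e18, e17, e16, e15, e14, e13, e12, e11, e10, e9, e8, e7, e6, e5, e4, e3, e2, e1,
        k0, Op.eval, h4]
  · rw [← p14v]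
    simp [e19, e18, e17, e16, e15, n6, c5, c8]

/-! ### Matrix entries, memory layout and correctness of an update. -/

/-- The entry of row `r`, column `i` of the sketch with modulus `q` whose row parameters are
`a`, `b`, `t`. -/
def entry (q a b t r i : ℕ) : ℕ := if (a * i + b) % q < t then (i + 1) ^ r % q else 0

/-- No overflow occurs, since `a * i + b ≤ (q - 1)^2 + (q - 1) < q^2`. -/
theorem row_value {w q a b t r i : ℕ} (ha : a < q) (hb : b < q) (hi : i < q)
    (ht : t ≤ q) (hw : q * q < 2 ^ w) :
    (if (BitVec.umod (BitVec.ofNat w a * BitVec.ofNat w i + BitVec.ofNat w b)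
      (BitVec.ofNat w q)).toNat < (BitVec.ofNat w t).toNat then (1 : BitVec w) else 0) *
      BitVec.ofNat w ((i + 1) ^ r % q) = BitVec.ofNat w (entry q a b t r i) := by
  have hqq : q ≤ q * q := Nat.le_mul_self q
  have h1 : a * i + b < 2 ^ w := by nlinarith
  have h2 : (BitVec.umod (BitVec.ofNat w a * BitVec.ofNat w i + BitVec.ofNat w b)
      (BitVec.ofNat w q)).toNat = (a * i + b) % q := by
    rw [← BitVec.ofNat_mul, ← BitVec.ofNat_add, BitVec.umod_eq, BitVec.toNat_umod,
      BitVec.toNat_ofNat, BitVec.toNat_ofNat, Nat.mod_eq_of_lt h1,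
      Nat.mod_eq_of_lt (show q < 2 ^ w by omega)]
  rw [h2, BitVec.toNat_ofNat, Nat.mod_eq_of_lt (by omega : t < 2 ^ w), entry]
  split <;> simp

theorem pow_mod_mul_umod {w q r i : ℕ} (hq : 0 < q) (hi : i + 1 ≤ q) (hw : q * q < 2 ^ w) :
    BitVec.umod (BitVec.ofNat w ((i + 1) ^ r % q) * BitVec.ofNat w (i + 1)) (BitVec.ofNat w q) =
      BitVec.ofNat w ((i + 1) ^ (r + 1) % q) := by
  have hqq : q ≤ q * q := Nat.le_mul_self q
  have h0 : (i + 1) ^ r % q < q := Nat.mod_lt _ hq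
  have h1 : (i + 1) ^ r % q * (i + 1) < 2 ^ w := by nlinarith
  apply BitVec.eq_of_toNat_eq
  have h3 : (i + 1) ^ (r + 1) % q < q := Nat.mod_lt _ hq
  rw [← BitVec.ofNat_mul, BitVec.umod_eq, BitVec.toNat_umod, BitVec.toNat_ofNat,
    BitVec.toNat_ofNat, BitVec.toNat_ofNat, Nat.mod_eq_of_lt h1,
    Nat.mod_eq_of_lt (show q < 2 ^ w by omega),
    Nat.mod_eq_of_lt (show (i + 1) ^ (r + 1) % q < 2 ^ w by omega), pow_succ, Nat.mod_mul_mod]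

/-- The memory `m` describes the sketch with modulus `q` and `D` rows, row `r` of which has
parameters `a r`, `b r`, `t r`. -/
structure Describes {s w : ℕ} (m : Mem s w) (q D : ℕ) (a b t : ℕ → ℕ) : Prop where
  modulus : rd m 2 = BitVec.ofNat w q
  rows : rd m 3 = BitVec.ofNat w D
  fst : ∀ r < D, rd m (16 + 4 * r) = BitVec.ofNat w (a r)
  snd : ∀ r < D, rd m (16 + 4 * r + 1) = BitVec.ofNat w (b r)
  thr : ∀ r < D, rd m (16 + 4 * r + 2) = BitVec.ofNat w (t r)

/-- The addresses of the words that updates leave unchanged. -/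
def IsStatic (x : ℕ) : Prop := x = 2 ∨ x = 3 ∨ 16 ≤ x ∧ x % 4 ≠ 3

theorem Describes.congr {s w : ℕ} {m m' : Mem s w} {q D : ℕ} {a b t : ℕ → ℕ}
    (h : Describes m q D a b t) (hm : ∀ x, IsStatic x → rd m' x = rd m x) :
    Describes m' q D a b t := by
  refine ⟨?_, ?_, fun r hr => ?_, fun r hr => ?_, fun r hr => ?_⟩
  · rw [hm 2 (by unfold IsStatic; omega), h.modulus]
  · rw [hm 3 (by unfold IsStatic; omega), h.rows]
  · rw [hm _ (by unfold IsStatic; omega), h.fst r hr]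
  · rw [hm _ (by unfold IsStatic; omega), h.snd r hr]
  · rw [hm _ (by unfold IsStatic; omega), h.thr r hr]

/-- Bounds on the parameters that exclude overflow in the computation of an entry. -/
structure Fits (w q D : ℕ) (a b t : ℕ → ℕ) : Prop where
  one_lt : 1 < q
  fst : ∀ r < D, a r < q
  snd : ∀ r < D, b r < q
  thr : ∀ r < D, t r ≤ q
  sq : q * q < 2 ^ w
  mem : 16 + 4 * D < 2 ^ w

/-- Loop invariant with `r` rows done and `k` left: only the counters of rows from `r` on still
change. Each row costs 19 steps and one test; the final test adds 1. -/
theorem run_loop {w q D i : ℕ} {a b t : ℕ → ℕ} (hf : Fits w q D a b t) (hi : i < q) (k : ℕ) :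
    ∀ (r : ℕ) (m : Mem (16 + 4 * D) w), r + k = D → Describes m q D a b t →
      rd m 0 = BitVec.ofNat w i → rd m 4 = BitVec.ofNat w 1 →
      rd m 5 = BitVec.ofNat w ((i + 1) ^ r % q) → rd m 6 = BitVec.ofNat w (16 + 4 * r) →
      rd m 7 = BitVec.ofNat w (i + 1) → rd m 8 = BitVec.ofNat w k →
      Reaches (.loop 8 rowProgram) m (20 * k + 1) fun m' =>
        (∀ x, IsStatic x → rd m' x = rd m x) ∧
        ∀ r' < D, rd m' (16 + 4 * r' + 3) = rd m (16 + 4 * r' + 3) +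
          if r ≤ r' then BitVec.ofNat w (entry q (a r') (b r') (t r') r' i) * rd m 1 else 0 := by
  have hw := hf.mem
  induction k with
  | zero =>
    intro r m hr hd h0 h4 h5 h6 h7 h8
    refine ⟨m, Run.loop_stop (by omega) ?_, fun _ _ => rfl, fun r' hr' => ?_⟩
    · have : rd m 8 = m ⟨8, by omega⟩ := by rw [rd, dif_pos]
      rw [← this, h8]; rfl
    · rw [if_neg (by omega)]; simp
  | succ k ih =>
    intro r m hr hd h0 h4 h5 h6 h7 h8
    obtain ⟨m₁, hrun, near, e5, e6, e8, ec, far⟩ :=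
      run_row m (16 + 4 * r) (by omega) (by omega) (by omega) h4 h6
    have hst : ∀ x, IsStatic x → rd m₁ x = rd m x := fun x hx => by
      rcases hx with rfl | rfl | ⟨h1, h2⟩
      · exact near _ (by omega)
      · exact near _ (by omega)
      · exact far _ h1 (by omega)
    obtain ⟨m₂, hrun₂, hst₂, hc₂⟩ := ih (r + 1) m₁ (by omega) (hd.congr hst)
      ((near 0 (by omega)).trans h0) ((near 4 (by omega)).trans h4)
      (by
        rw [e5, h5, h7, hd.modulus, pow_mod_mul_umod (by have := hf.one_lt; omega) (by omega)
          hf.sq]) e6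
      ((near 7 (by omega)).trans h7)
      (by
        rw [e8, h8, BitVec.ofNat_add]
        simp)
    refine ⟨m₂, ?_, fun x hx => (hst₂ x hx).trans (hst x hx), fun r' hr' => ?_⟩
    · have := Run.loop_step (a := 8) (by omega) ?_ hrun hrun₂
      · convert this using 1; ring
      · have e : rd m 8 = m ⟨8, by omega⟩ := by rw [rd, dif_pos]
        rw [← e, h8]
        intro h
        have := congrArg BitVec.toNat h
        rw [BitVec.toNat_ofNat, Nat.mod_eq_of_lt (by omega)] at this
        simp at this
    · rw [hc₂ r' hr', near 1 (by omega)]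
      by_cases hrr : r' = r
      · subst hrr
        rw [if_neg (by omega), if_pos le_rfl, ec, hd.fst _ hr', hd.snd _ hr', hd.thr _ hr', h0, h5,
          hd.modulus, row_value (hf.fst _ hr') (hf.snd _ hr') hi (hf.thr _ hr') hf.sq]
        simp
      · rw [far _ (by omega) (by omega)]
        by_cases hlt : r + 1 ≤ r'
        · rw [if_pos hlt, if_pos (by omega)]
        · rw [if_neg hlt, if_neg (by omega)]

theorem run_update {w q D i : ℕ} {a b t : ℕ → ℕ} (hf : Fits w q D a b t) (hi : i < q)
    (m : Mem (16 + 4 * D) w) (hd : Describes m q D a b t) (h0 : rd m 0 = BitVec.ofNat w i) :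
    Reaches updateProgram m (20 * D + 6) fun m' =>
      (∀ x, IsStatic x → rd m' x = rd m x) ∧
      ∀ r < D, rd m' (16 + 4 * r + 3) = rd m (16 + 4 * r + 3) +
        BitVec.ofNat w (entry q (a r) (b r) (t r) r i) * rd m 1 := by
  unfold updateProgram
  refine reaches_const m (by omega) fun m1 e1 => ?_
  refine reaches_const m1 (by omega) fun m2 e2 => ?_
  refine reaches_const m2 (by omega) fun m3 e3 => ?_
  refine reaches_op m3 (by omega) (by omega) (by omega) fun m4 e4 => ?_
  refine reaches_op m4 (by omega) (by omega) (by omega) fun m5 e5 => ?_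
  have hne : ∀ x, x < 4 ∨ 9 ≤ x → rd m5 x = rd m x := fun x hx => by
    have a4 : x ≠ 4 := by omega
    have a5 : x ≠ 5 := by omega
    have a6 : x ≠ 6 := by omega
    have a7 : x ≠ 7 := by omega
    have a8 : x ≠ 8 := by omega
    simp [e5, e4, e3, e2, e1, a4, a5, a6, a7, a8]
  have hst : ∀ x, IsStatic x → rd m5 x = rd m x := fun x hx =>
    hne x (by unfold IsStatic at hx; omega)
  obtain ⟨m', hrun, hs', hc'⟩ := run_loop hf hi D 0 m5 (by omega) (hd.congr hst)
    ((hne 0 (by omega)).trans h0) (by simp [e5, e4, e3, e2, e1])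
    (by
      rw [pow_zero]
      have h1 : rd m5 5 = BitVec.ofNat w 1 := by simp [e5, e4, e3, e2]
      rw [h1, Nat.mod_eq_of_lt hf.one_lt])
    (by simp [e5, e4, e3])
    (by simp [e5, e4, e3, e2, e1, h0, Op.eval, BitVec.ofNat_add])
    (by simp [e5, e4, e3, e2, e1, hd.rows, Op.eval])
  refine ⟨m', hrun, fun x hx => (hs' x hx).trans (hst x hx), fun r hr => ?_⟩
  rw [hc' r hr, hne _ (by omega), hne 1 (by omega), if_pos (Nat.zero_le _)]

/-- The matrix with entries `entry`. -/
def paramMatrix (n q D : ℕ) (a b t : ℕ → ℕ) : Matrix (Fin D) (Fin n) ℤ :=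
  fun r i => (entry q (a r) (b r) (t r) r i : ℤ)

/-- The matrix that a memory describes. -/
def memMatrix (n : ℕ) {D w : ℕ} (m : Mem (16 + 4 * D) w) : Matrix (Fin D) (Fin n) ℤ :=
  paramMatrix n (rd m 2).toNat D (fun r => (rd m (16 + 4 * r)).toNat)
    (fun r => (rd m (16 + 4 * r + 1)).toNat) (fun r => (rd m (16 + 4 * r + 2)).toNat)

/-- The initial memory for given row parameters. -/
def initMem (w q D : ℕ) (a b t : ℕ → ℕ) : Mem (16 + 4 * D) w := fun x =>
  if x.val = 2 then BitVec.ofNat w q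
  else if x.val = 3 then BitVec.ofNat w D
  else if x.val < 16 then 0
  else if x.val % 4 = 0 then BitVec.ofNat w (a ((x.val - 16) / 4))
  else if x.val % 4 = 1 then BitVec.ofNat w (b ((x.val - 16) / 4))
  else if x.val % 4 = 2 then BitVec.ofNat w (t ((x.val - 16) / 4))
  else 0

theorem describes_initMem (w q D : ℕ) (a b t : ℕ → ℕ) :
    Describes (initMem w q D a b t) q D a b t := by
  refine ⟨?_, ?_, fun r hr => ?_, fun r hr => ?_, fun r hr => ?_⟩
  · rw [rd, dif_pos (by omega)]; simp [initMem]
  · rw [rd, dif_pos (by omega)]; simp [initMem]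
  · rw [rd, dif_pos (by omega), initMem]
    simp only [show 16 + 4 * r ≠ 2 by omega, show 16 + 4 * r ≠ 3 by omega,
      show ¬ 16 + 4 * r < 16 by omega, show (16 + 4 * r) % 4 = 0 by omega,
      show (16 + 4 * r - 16) / 4 = r by omega, if_true, if_false]
  · rw [rd, dif_pos (by omega), initMem]
    simp only [show 16 + 4 * r + 1 ≠ 2 by omega, show 16 + 4 * r + 1 ≠ 3 by omega,
      show ¬ 16 + 4 * r + 1 < 16 by omega, show (16 + 4 * r + 1) % 4 = 1 by omega,
      show (16 + 4 * r + 1 - 16) / 4 = r by omega, if_true, if_false, one_ne_zero]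
  · rw [rd, dif_pos (by omega), initMem]
    simp only [show 16 + 4 * r + 2 ≠ 2 by omega, show 16 + 4 * r + 2 ≠ 3 by omega,
      show ¬ 16 + 4 * r + 2 < 16 by omega, show (16 + 4 * r + 2) % 4 = 2 by omega,
      show (16 + 4 * r + 2 - 16) / 4 = r by omega, if_true, if_false, OfNat.ofNat_ne_zero,
      OfNat.ofNat_ne_one]

theorem initMem_cell (w q D : ℕ) (a b t : ℕ → ℕ) {r : ℕ} (hr : r < D) :
    rd (initMem w q D a b t) (16 + 4 * r + 3) = 0 := by
  rw [rd, dif_pos (by omega), initMem]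
  simp only [show 16 + 4 * r + 3 ≠ 2 by omega, show 16 + 4 * r + 3 ≠ 3 by omega,
    show ¬ 16 + 4 * r + 3 < 16 by omega, show (16 + 4 * r + 3) % 4 = 3 by omega, if_false,
    OfNat.ofNat_ne_zero, OfNat.ofNat_ne_one, show (3 : ℕ) ≠ 2 by omega]

theorem Describes.memMatrix_eq {n w q D : ℕ} {a b t : ℕ → ℕ} {m : Mem (16 + 4 * D) w}
    (hd : Describes m q D a b t) (hf : Fits w q D a b t) :
    memMatrix n m = paramMatrix n q D a b t := by
  have hqq : q ≤ q * q := Nat.le_mul_self q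
  have hsq := hf.sq
  funext r i
  have ha := hf.fst r r.2
  have hb := hf.snd r r.2
  have ht := hf.thr r r.2
  have h : ∀ x, x ≤ q → (BitVec.ofNat w x).toNat = x := fun x hx => by
    rw [BitVec.toNat_ofNat, Nat.mod_eq_of_lt (by omega)]
  simp only [memMatrix, paramMatrix, hd.modulus, hd.fst r r.2, hd.snd r r.2, hd.thr r r.2]
  rw [h q le_rfl, h _ ha.le, h _ hb.le, h _ ht]

/-! ### Processing a stream, and the sketch given by random row parameters. -/

theorem rd_present {n s w : ℕ} (hs : 2 ≤ s) (m : Mem s w) (e : Fin n × ℤ) (x : ℕ) :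
    rd (present m e) x = if x = 0 then BitVec.ofNat w e.1.val
      else if x = 1 then BitVec.ofInt w e.2 else rd m x := by
  unfold rd present
  by_cases hx : x < s
  · simp [hx]
  · simp [hx, show x ≠ 0 by omega, show x ≠ 1 by omega]

theorem processes_update {n w q D : ℕ} {a b t : ℕ → ℕ} (hf : Fits w q D a b t) (hn : n ≤ q)
    (u : List (Fin n × ℤ)) : ∀ m : Mem (16 + 4 * D) w, Describes m q D a b t →
      ∃ m', Processes updateProgram (20 * D + 6) m u m' ∧ Describes m' q D a b t ∧
        ∀ r : Fin D, rd m' (16 + 4 * r + 3) = rd m (16 + 4 * r + 3) +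
          BitVec.ofInt w ((u.map fun e => paramMatrix n q D a b t r e.1 * e.2).sum) := by
  induction u with
  | nil => exact fun m hd => ⟨m, .nil m, hd, fun r => by simp⟩
  | cons e u ih =>
    intro m hd
    have hp := rd_present (by omega) m e
    obtain ⟨m₁, hrun, hst, hc⟩ := run_update (i := e.1.val) hf (by omega) (present m e)
      (hd.congr fun x hx => by
        unfold IsStatic at hx
        rw [hp, if_neg (by omega), if_neg (by omega)]) (by rw [hp, if_pos rfl])
    have hd₁ : Describes m₁ q D a b t := hd.congr fun x hx => by
      rw [hst x hx]
      unfold IsStatic at hx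
      rw [hp, if_neg (by omega), if_neg (by omega)]
    obtain ⟨m₂, hproc, hd₂, hc₂⟩ := ih m₁ hd₁
    refine ⟨m₂, .cons hrun le_rfl hproc, hd₂, fun r => ?_⟩
    rw [hc₂ r, hc r r.2, hp, hp, if_neg (by omega), if_neg (by omega), if_neg (by omega),
      if_pos rfl, List.map_cons, List.sum_cons, BitVec.ofInt_add, BitVec.ofInt_mul, ← add_assoc]
    simp [paramMatrix, BitVec.ofInt_natCast]

theorem mulVec_result {n D : ℕ} (S : Matrix (Fin D) (Fin n) ℤ) (u : List (Fin n × ℤ))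
    (r : Fin D) : S.mulVec (result u) r = (u.map fun e => S r e.1 * e.2).sum := by
  induction u with
  | nil => simp [result]
  | cons e u ih =>
    have : result (e :: u) = Pi.single e.1 e.2 + result u := by simp [result]
    rw [this, Matrix.mulVec_add, Pi.add_apply, ih, List.map_cons, List.sum_cons]
    simp

theorem entry_lt {q : ℕ} (hq : 0 < q) (a b t r i : ℕ) : entry q a b t r i < q := by
  unfold entry
  split
  · exact Nat.mod_lt _ hq
  · exact hq

theorem abs_mulVec_result_le {n q D m M : ℕ} (hq : 0 < q) (a b t : ℕ → ℕ)
    {u : List (Fin n × ℤ)} (hu : Valid m M u) (r : Fin D) :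
    |(paramMatrix n q D a b t).mulVec (result u) r| ≤ ((q * (m * M) : ℕ) : ℤ) := by
  rw [mulVec_result]
  obtain ⟨hlen, hM⟩ := hu
  have key : |(u.map fun e => paramMatrix n q D a b t r e.1 * e.2).sum| ≤
      (u.length : ℤ) * (q * M) := by
    clear hlen
    induction u with
    | nil => simp
    | cons e u ih =>
      have h1 := ih fun e' he' => hM e' (List.mem_cons_of_mem _ he')
      have h2 := hM e List.mem_cons_self
      have h3 : |paramMatrix n q D a b t r e.1| ≤ (q : ℤ) := by
        rw [paramMatrix, Nat.abs_cast]
        exact_mod_cast (entry_lt hq _ _ _ _ _).le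
      have h4 : |paramMatrix n q D a b t r e.1 * e.2| ≤ (q : ℤ) * M := by
        rw [abs_mul]
        exact mul_le_mul h3 h2 (abs_nonneg _) (by positivity)
      rw [List.map_cons, List.sum_cons, List.length_cons]
      refine (abs_add_le _ _).trans ?_
      push_cast
      linarith
  refine key.trans ?_
  push_cast
  have : (u.length : ℤ) ≤ m := by exact_mod_cast hlen
  nlinarith [mul_nonneg (Int.natCast_nonneg q) (Int.natCast_nonneg M)]

/-- Random row parameters define a linear sketch. -/
noncomputable def sketch {Ω : Type*} [Fintype Ω] [Nonempty Ω] (n w q D : ℕ)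
    (a b t : Ω → ℕ → ℕ) (answer : Matrix (Fin D) (Fin n) ℤ → (Fin D → ℤ) → ℝ) :
    LinearSketch n where
  dim := D
  words := 16 + 4 * D
  wordBits := w
  start := (PMF.uniformOfFintype Ω).map fun ω => initMem w q D (a ω) (b ω) (t ω)
  mat := memMatrix n
  cell := ⟨fun r => ⟨16 + 4 * r.val + 3, by omega⟩, fun r r' h => by
    have := congrArg Fin.val h
    ext
    simp only at this
    omega⟩
  answer := answer

/-- Counters are correct modulo `2^w` at all times because `BitVec.ofInt` respects sums and
products. The final value is at most `q * (m * M) < 2^(w - 1)` in absolute value, so its signed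
reading is exact. -/
theorem sketch_maintained {Ω : Type*} [Fintype Ω] [Nonempty Ω] {n w q D m M : ℕ}
    {a b t : Ω → ℕ → ℕ} {answer : Matrix (Fin D) (Fin n) ℤ → (Fin D → ℤ) → ℝ}
    (hf : ∀ ω, Fits w q D (a ω) (b ω) (t ω)) (hn : n ≤ q) (hw : q * (m * M) < 2 ^ (w - 1)) :
    (sketch n w q D a b t answer).MaintainedBy updateProgram (20 * D + 6) m M := by
  intro μ₀ hμ u hu
  obtain ⟨ω, -, rfl⟩ := (PMF.mem_support_map_iff _ _ _).1 hμ
  have hd := describes_initMem w q D (a ω) (b ω) (t ω)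
  obtain ⟨μ₁, hproc, hd₁, hc⟩ := processes_update (hf ω) hn u _ hd
  have hmat := hd.memMatrix_eq (n := n) (hf ω)
  refine ⟨μ₁, hproc, (hd₁.memMatrix_eq (hf ω)).trans hmat.symm, ?_⟩
  suffices h : ∀ r : Fin D, (rd μ₁ (16 + 4 * r.val + 3)).toInt =
      (memMatrix n (initMem w q D (a ω) (b ω) (t ω))).mulVec (result u) r by
    intro r
    have hr : r.val < D := r.2
    have e : rd μ₁ (16 + 4 * r.val + 3) = μ₁ ⟨16 + 4 * r.val + 3, by omega⟩ := by
      rw [rd, dif_pos]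
    exact (congrArg BitVec.toInt e.symm).trans (h r)
  intro r
  have hq : 0 < q := by have := (hf ω).one_lt; omega
  have habs := abs_le.1 (abs_mulVec_result_le hq (a ω) (b ω) (t ω) hu r)
  have h2 : 2 ^ (w - 1) * 2 = 2 ^ w := by
    rw [← pow_succ]
    congr 1
    rcases w with _ | w
    · have := (hf ω).mem
      simp at this
    · rfl
  have h3 : ((2 ^ w : ℕ) : ℤ) = 2 * ((2 ^ (w - 1) : ℕ) : ℤ) := by rw [← h2]; push_cast; ring
  have h4 : ((q * (m * M) : ℕ) : ℤ) < ((2 ^ (w - 1) : ℕ) : ℤ) := by exact_mod_cast hw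
  rw [hmat, hc r, initMem_cell _ _ _ _ _ _ r.2, zero_add, ← mulVec_result,
    BitVec.toInt_ofInt, Int.bmod_eq_of_le_mul_two]
  · linarith [habs.1]
  · linarith [habs.2]

/-- The success probability of a sketch with random row parameters, as a count. -/
theorem sketch_approximates {Ω : Type*} [Fintype Ω] [Nonempty Ω] {n w q D : ℕ}
    {a b t : Ω → ℕ → ℕ} {answer : Matrix (Fin D) (Fin n) ℤ → (Fin D → ℤ) → ℝ}
    (hf : ∀ ω, Fits w q D (a ω) (b ω) (t ω)) (x : Fin n → ℤ) (f ε δ : ℝ) (Bad : Finset Ω)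
    (hbad : ∀ ω, ω ∉ Bad → |answer (paramMatrix n q D (a ω) (b ω) (t ω))
      ((paramMatrix n q D (a ω) (b ω) (t ω)).mulVec x) - f| ≤ ε * f)
    (hcard : (Bad.card : ℝ) ≤ δ * Fintype.card Ω) :
    (sketch n w q D a b t answer).Approximates x f ε δ := by
  classical
  unfold LinearSketch.Approximates
  have hΩ : (0 : ℝ) < Fintype.card Ω := by exact_mod_cast Fintype.card_pos
  have h1 : ((PMF.uniformOfFintype Ω).map fun ω =>
      (initMem w q D (a ω) (b ω) (t ω) : Mem (16 + 4 * D) w)).toOuterMeasure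
      {μ | |answer (memMatrix n μ) ((memMatrix n μ).mulVec x) - f| ≤ ε * f} ≥
      (PMF.uniformOfFintype Ω).toOuterMeasure (↑(Badᶜ) : Set Ω) := by
    rw [PMF.toOuterMeasure_map_apply]
    apply MeasureTheory.measure_mono
    intro ω hω
    have := hbad ω (by simpa using hω)
    rw [Set.mem_preimage, Set.mem_ofPred_eq, (describes_initMem w q D _ _ _).memMatrix_eq (hf ω)]
    exact this
  refine le_trans ?_ h1
  rw [PMF.toOuterMeasure_uniformOfFintype_apply]
  have h2 : Fintype.card ↥(↑(Badᶜ) : Set Ω) = Fintype.card Ω - Bad.card := by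
    rw [← Finset.card_compl, ← Fintype.card_coe]
    exact Fintype.card_congr (Equiv.refl _)
  rw [h2]
  have h3 : ((Fintype.card Ω - Bad.card : ℕ) : ENNReal) / (Fintype.card Ω : ENNReal) =
      ENNReal.ofReal (((Fintype.card Ω - Bad.card : ℕ) : ℝ) / (Fintype.card Ω : ℝ)) := by
    rw [ENNReal.ofReal_div_of_pos hΩ, ENNReal.ofReal_natCast, ENNReal.ofReal_natCast]
  rw [h3]
  apply ENNReal.ofReal_le_ofReal
  rw [le_div_iff₀ hΩ, Nat.cast_sub (Finset.card_le_univ _)]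
  linarith

/-! ### Pairwise independent hashing and second moments. -/

theorem hash_val (q : ℕ) [Fact q.Prime] (a b : ZMod q) (i : ℕ) :
    (a * i + b).val = (a.val * i + b.val) % q := by
  rw [ZMod.val_add, ZMod.val_mul, ZMod.val_natCast]
  simp [Nat.add_mod, Nat.mul_mod]

theorem sum_affine {q : ℕ} [Fact q.Prime] (F : ZMod q → ℝ) (x : ZMod q) :
    ∑ s : ZMod q × ZMod q, F (s.1 * x + s.2) = q * ∑ u, F u := by
  rw [Fintype.sum_prod_type]
  have : ∀ a : ZMod q, ∑ b, F (a * x + b) = ∑ u, F u := fun a =>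
    Fintype.sum_equiv (Equiv.addLeft (a * x)) _ _ fun _ => rfl
  simp [this, ZMod.card]

/-- Pairwise independence: for `x ≠ y` the map `(a, b) ↦ (a x + b, a y + b)` is a bijection of the
plane over the field `ZMod q`. -/
theorem sum_affine_mul {q : ℕ} [Fact q.Prime] (F G : ZMod q → ℝ) {x y : ZMod q} (h : x ≠ y) :
    ∑ s : ZMod q × ZMod q, F (s.1 * x + s.2) * G (s.1 * y + s.2) = (∑ u, F u) * ∑ u, G u := by
  rw [Finset.sum_mul_sum, ← Fintype.sum_prod_type']
  let φ : ZMod q × ZMod q → ZMod q × ZMod q := fun s => (s.1 * x + s.2, s.1 * y + s.2)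
  have hφ : Function.Injective φ := by
    rintro ⟨a, b⟩ ⟨a', b'⟩ e
    obtain ⟨e₁, e₂⟩ := Prod.mk.inj e
    simp only at e₁ e₂
    have e₃ : (a - a') * (x - y) = 0 := by linear_combination e₁ - e₂
    have e₄ : a = a' := by
      rcases mul_eq_zero.1 e₃ with h' | h'
      · exact sub_eq_zero.1 h'
      · exact absurd (sub_eq_zero.1 h') h
    subst e₄
    rw [add_left_cancel e₁]
  exact Fintype.sum_bijective φ (Finite.injective_iff_bijective.1 hφ) _ _ fun _ => rfl

theorem card_val_lt {q : ℕ} [NeZero q] {t : ℕ} (ht : t ≤ q) :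
    (Finset.univ.filter fun u : ZMod q => u.val < t).card = t := by
  rw [← Finset.card_range t]
  refine Finset.card_bij (fun u _ => u.val) (fun u hu => ?_) (fun u _ v _ h => ?_) fun k hk => ?_
  · simpa using hu
  · exact ZMod.val_injective q h
  · have hk' : k < q := (Finset.mem_range.1 hk).trans_le ht
    exact ⟨k, by simpa [ZMod.val_natCast, Nat.mod_eq_of_lt hk'] using hk,
      by simp [ZMod.val_natCast, Nat.mod_eq_of_lt hk']⟩

/-- Second moment of the number of hash values below a threshold, for a random affine hash
function. -/
theorem second_moment_le {q : ℕ} [Fact q.Prime] {ι : Type*} (U : Finset ι) (pt : ι → ZMod q)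
    (hpt : Set.InjOn pt U) {t : ℕ} (ht : t ≤ q) :
    ∑ s : ZMod q × ZMod q,
      (((U.filter fun i => (s.1 * pt i + s.2).val < t).card : ℝ) - t / q * U.card) ^ 2 ≤
      q ^ 2 * (t / q * U.card) := by
  classical
  have hq : (0 : ℝ) < q := by exact_mod_cast (Fact.out : q.Prime).pos
  set c : ℝ := t / q with hc
  have hcq : c * q = t := by rw [hc]; field_simp
  have hc0 : 0 ≤ c := by positivity
  have hc1 : c ≤ 1 := by
    rw [hc, div_le_one hq]; exact_mod_cast ht
  -- The centred indicator has sum zero, so all off-diagonal terms of the expanded square vanish;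
  -- each diagonal term contributes at most `q * t`.
  let F : ZMod q → ℝ := fun u => (if u.val < t then 1 else 0) - c
  have hsum1 : ∑ u : ZMod q, (if u.val < t then (1 : ℝ) else 0) = t := by
    rw [Finset.sum_boole, card_val_lt ht]
  have hF0 : ∑ u, F u = 0 := by
    simp only [F, Finset.sum_sub_distrib, hsum1, Finset.sum_const, Finset.card_univ, ZMod.card,
      nsmul_eq_mul]
    linarith
  have hF2 : ∑ u, F u * F u ≤ t := by
    have : ∀ u : ZMod q, F u * F u ≤ (if u.val < t then (1 : ℝ) else 0) * (1 - 2 * c) + c ^ 2 := by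
      intro u
      simp only [F]
      split <;> nlinarith
    refine (Finset.sum_le_sum fun u _ => this u).trans ?_
    rw [Finset.sum_add_distrib, ← Finset.sum_mul, hsum1, Finset.sum_const, Finset.card_univ,
      ZMod.card, nsmul_eq_mul, ← hcq]
    nlinarith [mul_nonneg hc0 hq.le, mul_nonneg (mul_nonneg hc0 hc0) hq.le]
  have hcount : ∀ s : ZMod q × ZMod q,
      ((U.filter fun i => (s.1 * pt i + s.2).val < t).card : ℝ) - c * U.card =
        ∑ i ∈ U, F (s.1 * pt i + s.2) := by
    intro s
    simp only [F, Finset.sum_sub_distrib, Finset.sum_boole, Finset.sum_const, nsmul_eq_mul]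
    ring
  simp only [hcount, sq (∑ i ∈ U, F _), Finset.sum_mul_sum]
  rw [Finset.sum_comm]
  have : ∀ i ∈ U, ∑ s : ZMod q × ZMod q, ∑ j ∈ U, F (s.1 * pt i + s.2) * F (s.1 * pt j + s.2) ≤
      q * t := by
    intro i hi
    rw [Finset.sum_comm, Finset.sum_eq_single_of_mem i hi]
    · rw [sum_affine (fun u => F u * F u) (pt i)]
      exact mul_le_mul_of_nonneg_left hF2 hq.le
    · intro j hj hji
      rw [sum_affine_mul F F (fun e => hji (hpt hj hi e.symm)), hF0, zero_mul]
  refine (Finset.sum_le_sum this).trans (le_of_eq ?_)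
  rw [Finset.sum_const, nsmul_eq_mul, ← hcq]
  ring

/-- The coordinates whose hash value is less than `t`. -/
def hashSet (n q t a b : ℕ) : Finset (Fin n) :=
  Finset.univ.filter fun i => (a * i.val + b) % q < t

/-- The squared deviations of the number of nonzero coordinates in `A`, and of the number of
occurrences of each value, from the fraction `c` of those in the whole vector. -/
noncomputable def deviation {n : ℕ} (A : Finset (Fin n)) (c : ℝ) (x : Fin n → ℤ) : ℝ :=
  (((A.filter fun i => x i ≠ 0).card : ℝ) -
      c * (Finset.univ.filter fun i => x i ≠ 0).card) ^ 2 +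
    ∑ v ∈ (Finset.univ.image x).erase 0, (((A.filter fun i => x i = v).card : ℝ) -
      c * (Finset.univ.filter fun i => x i = v).card) ^ 2

theorem card_ne_zero_eq_sum {n : ℕ} (A : Finset (Fin n)) (x : Fin n → ℤ) :
    (A.filter fun i => x i ≠ 0).card =
      ∑ v ∈ (Finset.univ.image x).erase 0, (A.filter fun i => x i = v).card := by
  rw [Finset.card_eq_sum_card_fiberwise (f := x) (t := (Finset.univ.image x).erase 0)]
  · refine Finset.sum_congr rfl fun v hv => ?_
    congr 1
    ext i
    simp only [Finset.mem_filter]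
    have := Finset.ne_of_mem_erase hv
    constructor
    · rintro ⟨⟨h1, -⟩, h3⟩; exact ⟨h1, h3⟩
    · rintro ⟨h1, h3⟩; exact ⟨⟨h1, h3 ▸ this⟩, h3⟩
  · intro i hi
    have := (Finset.mem_filter.1 hi).2
    simp [this]

/-- The factor 2 arises because the nonzero coordinates enter twice: once as a whole, and once split
by value, where the variance bounds add up to the same total. -/
theorem sum_deviation_le {n q t : ℕ} [Fact q.Prime] (hn : n ≤ q) (ht : t ≤ q) (x : Fin n → ℤ) :
    ∑ s : ZMod q × ZMod q, deviation (hashSet n q t s.1.val s.2.val) (t / q) x ≤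
      q ^ 2 * (2 * (t / q * (Finset.univ.filter fun i => x i ≠ 0).card)) := by
  have hpt : Function.Injective fun i : Fin n => ((i.val : ℕ) : ZMod q) := by
    intro i j h
    have := (ZMod.natCast_eq_natCast_iff' _ _ _).1 h
    rw [Nat.mod_eq_of_lt (by omega), Nat.mod_eq_of_lt (by omega)] at this
    exact Fin.ext this
  have key : ∀ Q : Fin n → Prop, [DecidablePred Q] → ∑ s : ZMod q × ZMod q,
      ((((hashSet n q t s.1.val s.2.val).filter Q).card : ℝ) -
        t / q * (Finset.univ.filter Q).card) ^ 2 ≤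
      q ^ 2 * (t / q * (Finset.univ.filter Q).card) := by
    intro Q _
    have e : ∀ s : ZMod q × ZMod q, (hashSet n q t s.1.val s.2.val).filter Q =
        (Finset.univ.filter Q).filter fun i => (s.1 * ((i.val : ℕ) : ZMod q) + s.2).val < t := by
      intro s
      ext i
      simp [hashSet, hash_val, and_comm]
    simp only [e]
    exact second_moment_le (Finset.univ.filter Q) (fun i => ((i.val : ℕ) : ZMod q)) hpt.injOn ht
  simp only [deviation]
  rw [Finset.sum_add_distrib, Finset.sum_comm]
  have h1 := key fun i => x i ≠ 0
  have h2 : ∑ v ∈ (Finset.univ.image x).erase 0, ∑ s : ZMod q × ZMod q,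
      ((((hashSet n q t s.1.val s.2.val).filter fun i => x i = v).card : ℝ) -
        t / q * (Finset.univ.filter fun i => x i = v).card) ^ 2 ≤
      q ^ 2 * (t / q * (Finset.univ.filter fun i => x i ≠ 0).card) := by
    refine (Finset.sum_le_sum fun v _ => key fun i => x i = v).trans (le_of_eq ?_)
    rw [card_ne_zero_eq_sum, ← Finset.mul_sum, ← Finset.mul_sum]
    push_cast
    rfl
  linarith

/-! ### Stability of the estimate and the lower bound for `n^p - F_p`. -/

theorem abs_rpow_sub_rpow_le {p a b B : ℝ} (hp : 1 ≤ p) (ha : 0 ≤ a) (hb : 0 ≤ b) (haB : a ≤ B)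
    (hbB : b ≤ B) : |a ^ p - b ^ p| ≤ p * B ^ (p - 1) * |a - b| := by
  have hconv : Convex ℝ (Set.Icc (0 : ℝ) B) := convex_Icc 0 B
  have := hconv.norm_image_sub_le_of_norm_hasDerivWithin_le (f := fun y : ℝ => y ^ p)
    (f' := fun y => p * y ^ (p - 1)) (C := p * B ^ (p - 1))
    (fun y _ => (Real.hasDerivAt_rpow_const (Or.inr hp)).hasDerivWithinAt)
    (fun y hy => by
      rw [Real.norm_eq_abs, abs_of_nonneg (by have := hy.1; positivity)]
      exact mul_le_mul_of_nonneg_left (Real.rpow_le_rpow hy.1 hy.2 (by linarith)) (by linarith))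
    (⟨hb, hbB⟩ : b ∈ Set.Icc (0 : ℝ) B) (⟨ha, haB⟩ : a ∈ Set.Icc (0 : ℝ) B)
  simpa [Real.norm_eq_abs] using this

/-- Stability of sums of `p`-th powers. -/
theorem abs_sum_rpow_sub_le {ι : Type*} {p : ℝ} (hp : 2 ≤ p) (W : Finset ι) (f f' : ι → ℝ)
    (hf : ∀ v ∈ W, 0 ≤ f v) (hf' : ∀ v ∈ W, 0 ≤ f' v) {g θ : ℝ} (hg : ∑ v ∈ W, f v = g)
    (hθ : 0 ≤ θ) (hθ1 : θ ≤ 1) (hdev : ∑ v ∈ W, (f' v - f v) ^ 2 ≤ (θ * g) ^ 2) :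
    |∑ v ∈ W, f' v ^ p - ∑ v ∈ W, f v ^ p| ≤ p * 2 ^ (p - 1) * θ * g ^ p := by
  have hg0 : 0 ≤ g := hg ▸ Finset.sum_nonneg hf
  have hd : ∀ v ∈ W, |f' v - f v| ≤ θ * g := fun v hv => by
    refine abs_le_of_sq_le_sq ?_ (by positivity)
    exact (Finset.single_le_sum (f := fun v => (f' v - f v) ^ 2) (fun _ _ => sq_nonneg _) hv).trans
      hdev
  have hfg : ∀ v ∈ W, f v ≤ g := fun v hv => hg ▸ Finset.single_le_sum hf hv
  -- With `p - 2 ≥ 0`, all but one factor of the derivative's power `p - 1` are bounded by `2 * g`.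
  -- What remains is linear in `f v`, and so amenable to Cauchy–Schwarz.
  have hterm : ∀ v ∈ W, |f' v ^ p - f v ^ p| ≤
      p * (2 * g) ^ (p - 2) * (|f' v - f v| * f v + (f' v - f v) ^ 2) := by
    intro v hv
    have h0 := hf v hv
    have h1 := abs_le.1 (hd v hv)
    have h2 : f' v ≤ f v + |f' v - f v| := by linarith [le_abs_self (f' v - f v)]
    have h3 : f v + |f' v - f v| ≤ 2 * g := by
      have := hfg v hv
      have := hd v hv
      nlinarith
    have h4 : 0 ≤ f v + |f' v - f v| := by positivity
    refine (abs_rpow_sub_rpow_le (B := f v + |f' v - f v|) (by linarith) (hf' v hv) h0 h2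
      (by linarith [abs_nonneg (f' v - f v)])).trans ?_
    have h5 : (f v + |f' v - f v|) ^ (p - 1) ≤ (2 * g) ^ (p - 2) * (f v + |f' v - f v|) := by
      have : p - 1 = (p - 2) + 1 := by ring
      rw [this, Real.rpow_add_one' h4 (by linarith)]
      exact mul_le_mul_of_nonneg_right (Real.rpow_le_rpow h4 h3 (by linarith)) h4
    calc p * (f v + |f' v - f v|) ^ (p - 1) * |f' v - f v|
        ≤ p * ((2 * g) ^ (p - 2) * (f v + |f' v - f v|)) * |f' v - f v| := by gcongr
      _ = p * (2 * g) ^ (p - 2) * (|f' v - f v| * f v + |f' v - f v| ^ 2) := by ring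
      _ = _ := by rw [sq_abs]
  have hcs : ∑ v ∈ W, |f' v - f v| * f v ≤ θ * g * g := by
    have h1 : ∑ v ∈ W, f v ^ 2 ≤ g ^ 2 := by
      have : ∀ v ∈ W, f v ^ 2 ≤ f v * g := fun v hv => by
        nlinarith [hf v hv, hfg v hv]
      refine (Finset.sum_le_sum this).trans ?_
      rw [← Finset.sum_mul, hg, sq]
    have h2 := Finset.sum_mul_sq_le_sq_mul_sq W (fun v => |f' v - f v|) f
    simp only [sq_abs] at h2
    refine (le_abs_self _).trans (abs_le_of_sq_le_sq ?_ (by positivity))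
    calc (∑ v ∈ W, |f' v - f v| * f v) ^ 2 ≤ _ := h2
      _ ≤ (θ * g) ^ 2 * g ^ 2 := by
        gcongr
      _ = _ := by ring
  rw [← Finset.sum_sub_distrib]
  have h2 : (0 : ℝ) ≤ p * (2 * g) ^ (p - 2) := by positivity
  calc |∑ v ∈ W, (f' v ^ p - f v ^ p)| ≤ ∑ v ∈ W, |f' v ^ p - f v ^ p| :=
        Finset.abs_sum_le_sum_abs _ _
    _ ≤ ∑ v ∈ W, p * (2 * g) ^ (p - 2) * (|f' v - f v| * f v + (f' v - f v) ^ 2) :=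
        Finset.sum_le_sum hterm
    _ = p * (2 * g) ^ (p - 2) * (∑ v ∈ W, |f' v - f v| * f v + ∑ v ∈ W, (f' v - f v) ^ 2) := by
        rw [← Finset.mul_sum, Finset.sum_add_distrib]
    _ ≤ p * (2 * g) ^ (p - 2) * (θ * g * g + (θ * g) ^ 2) := by gcongr
    _ ≤ p * (2 * g) ^ (p - 2) * (θ * g * g + θ * g * g) := by
        gcongr
        nlinarith [mul_nonneg (mul_nonneg hθ hg0) hg0]
    _ = p * 2 ^ (p - 1) * θ * g ^ p := by
        have e : g ^ p = g ^ (p - 2) * g ^ 2 := by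
          rw [← Real.rpow_natCast g 2, ← Real.rpow_add' hg0 (by push_cast; linarith)]
          push_cast
          ring_nf
        rw [Real.mul_rpow (by norm_num) hg0, show p - 1 = (p - 2) + 1 by ring,
          Real.rpow_add_one (by norm_num), e]
        ring

/-- The estimate of `n ^ p - F_p` from a vector whose nonzero part is sampled at rate `c`. -/
noncomputable def estimate (p : ℝ) {n : ℕ} (c : ℝ) (z : Fin n → ℤ) : ℝ :=
  (n : ℝ) ^ p - (n - min (n : ℝ) ((Finset.univ.filter fun i => z i ≠ 0).card / c)) ^ p -
    ∑ v ∈ (Finset.univ.image z).erase 0, ((Finset.univ.filter fun i => z i = v).card / c : ℝ) ^ p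

theorem freqMoment_eq {n : ℕ} {p : ℝ} (hp : p ≠ 0) (x : Fin n → ℤ) :
    freqMoment p x = ((n : ℝ) - (Finset.univ.filter fun i => x i ≠ 0).card) ^ p +
      ∑ v ∈ (Finset.univ.image x).erase 0, ((Finset.univ.filter fun i => x i = v).card : ℝ) ^ p := by
  have h : ((n : ℝ) - (Finset.univ.filter fun i => x i ≠ 0).card) =
      (Finset.univ.filter fun i => x i = 0).card := by
    have := Finset.card_filter_add_card_filter_not (s := (Finset.univ : Finset (Fin n)))
      (fun i => x i = 0)
    rw [Finset.card_univ, Fintype.card_fin] at this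
    rw [sub_eq_iff_eq_add]
    exact_mod_cast this.symm
  rw [h, freqMoment]
  by_cases h0 : (0 : ℤ) ∈ Finset.univ.image x
  · exact (Finset.add_sum_erase _ (fun v : ℤ =>
      ((Finset.univ.filter fun i => x i = v).card : ℝ) ^ p) h0).symm
  · rw [Finset.erase_eq_of_notMem h0]
    have : (Finset.univ.filter fun i => x i = 0) = ∅ := by
      rw [Finset.filter_eq_empty_iff]
      intro i _ hi
      exact h0 (Finset.mem_image.2 ⟨i, Finset.mem_univ _, hi⟩)
    rw [this, Finset.card_empty, Nat.cast_zero, Real.zero_rpow hp, zero_add]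

/-- This permits making a frequent value zero, so that only the few remaining coordinates need to be
sampled. -/
theorem freqMoment_sub_const {n : ℕ} (p : ℝ) (x : Fin n → ℤ) (v : ℤ) :
    freqMoment p (fun i => x i - v) = freqMoment p x := by
  unfold freqMoment
  have : Finset.univ.image (fun i => x i - v) = (Finset.univ.image x).image fun y => y - v := by
    rw [Finset.image_image]; rfl
  rw [this, Finset.sum_image fun a _ b _ h => sub_left_injective h]
  simp

/-- The part of `x` supported in `A`. -/
def restrict {n : ℕ} (A : Finset (Fin n)) (x : Fin n → ℤ) : Fin n → ℤ :=
  fun i => if i ∈ A then x i else 0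

theorem estimate_restrict {n : ℕ} {p : ℝ} (hp : p ≠ 0) (A : Finset (Fin n)) (c : ℝ)
    (x : Fin n → ℤ) : estimate p c (restrict A x) = (n : ℝ) ^ p -
      (n - min (n : ℝ) ((A.filter fun i => x i ≠ 0).card / c)) ^ p -
        ∑ v ∈ (Finset.univ.image x).erase 0, ((A.filter fun i => x i = v).card / c : ℝ) ^ p := by
  have h1 : (Finset.univ.filter fun i => restrict A x i ≠ 0) = A.filter fun i => x i ≠ 0 := by
    ext i; simp [restrict]
  have h2 : ∀ v, v ≠ 0 → (Finset.univ.filter fun i => restrict A x i = v) =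
      A.filter fun i => x i = v := by
    intro v hv
    ext i
    rw [Finset.mem_filter, Finset.mem_filter]
    by_cases hi : i ∈ A <;> simp [restrict, hi, hv.symm]
  rw [estimate, h1]
  congr 1
  have h3 : (Finset.univ.image (restrict A x)).erase 0 ⊆ (Finset.univ.image x).erase 0 := by
    intro v hv
    obtain ⟨hv0, hv⟩ := Finset.mem_erase.1 hv
    obtain ⟨i, -, rfl⟩ := Finset.mem_image.1 hv
    refine Finset.mem_erase.2 ⟨hv0, Finset.mem_image.2 ⟨i, Finset.mem_univ _, ?_⟩⟩
    by_contra h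
    by_cases hi : i ∈ A <;> simp [restrict, hi] at hv0 h
  rw [← Finset.sum_subset h3]
  · exact Finset.sum_congr rfl fun v hv => by rw [h2 v (Finset.ne_of_mem_erase hv)]
  · intro v hv hv'
    have hv0 := Finset.ne_of_mem_erase hv
    rw [← h2 v hv0, Finset.card_eq_zero.2, Nat.cast_zero, zero_div, Real.zero_rpow hp]
    rw [Finset.filter_eq_empty_iff]
    intro i _ hi
    exact hv' (Finset.mem_erase.2 ⟨hv0, Finset.mem_image.2 ⟨i, Finset.mem_univ _, hi⟩⟩)

/-- The value 0 contributes `(n - g)^p`, whose error follows from the mean value theorem; the other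
values are handled by `abs_sum_rpow_sub_le` and `g^p ≤ n^(p-1) g`. -/
theorem abs_estimate_sub_le {n : ℕ} {p : ℝ} (hp : 2 ≤ p) (A : Finset (Fin n)) {c θ : ℝ}
    (hc : 0 < c) (hθ : 0 ≤ θ) (hθ1 : θ ≤ 1) (x : Fin n → ℤ)
    (hdev : deviation A c x ≤ (θ * (c * (Finset.univ.filter fun i => x i ≠ 0).card)) ^ 2) :
    |estimate p c (restrict A x) - ((n : ℝ) ^ p - freqMoment p x)| ≤
      p * (1 + 2 ^ (p - 1)) * θ *
        ((n : ℝ) ^ (p - 1) * (Finset.univ.filter fun i => x i ≠ 0).card) := by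
  rw [estimate_restrict (by linarith), freqMoment_eq (by linarith)]
  set W := (Finset.univ.image x).erase 0 with hW
  set g : ℝ := ((Finset.univ.filter fun i => x i ≠ 0).card : ℝ) with hg
  set N : ℝ := ((A.filter fun i => x i ≠ 0).card : ℝ) with hN
  have hg0 : 0 ≤ g := by positivity
  have hgn : g ≤ n := by
    have := Finset.card_le_univ (Finset.univ.filter fun i => x i ≠ 0)
    rw [Fintype.card_fin] at this
    exact Nat.cast_le.2 this
  have hsplit : (N - c * g) ^ 2 ≤ (θ * (c * g)) ^ 2 ∧
      ∑ v ∈ W, (((A.filter fun i => x i = v).card : ℝ) -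
        c * (Finset.univ.filter fun i => x i = v).card) ^ 2 ≤ (θ * (c * g)) ^ 2 := by
    have h1 : 0 ≤ (N - c * g) ^ 2 := sq_nonneg _
    have h2 : 0 ≤ ∑ v ∈ W, (((A.filter fun i => x i = v).card : ℝ) -
        c * (Finset.univ.filter fun i => x i = v).card) ^ 2 :=
      Finset.sum_nonneg fun _ _ => sq_nonneg _
    unfold deviation at hdev
    constructor <;> linarith
  have hNg : |N / c - g| ≤ θ * g := by
    have : N / c - g = (N - c * g) / c := by field_simp
    rw [this, abs_div, abs_of_pos hc, div_le_iff₀ hc]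
    exact (abs_le_of_sq_le_sq hsplit.1 (by positivity)).trans (le_of_eq (by ring))
  -- Truncation at `n` keeps the base of the power nonnegative, and it only brings the estimate
  -- closer to `g ≤ n`.
  have hmin : |min (n : ℝ) (N / c) - g| ≤ θ * g := by
    refine le_trans ?_ hNg
    rcases le_total (n : ℝ) (N / c) with h | h
    · rw [min_eq_left h, abs_of_nonneg (by linarith), abs_of_nonneg (by linarith)]
      linarith
    · rw [min_eq_right h]
  have hmin0 : 0 ≤ min (n : ℝ) (N / c) := by positivity
  have h1 : |((n : ℝ) - min (n : ℝ) (N / c)) ^ p - (n - g) ^ p| ≤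
      p * (n : ℝ) ^ (p - 1) * (θ * g) := by
    refine (abs_rpow_sub_rpow_le (B := (n : ℝ)) (by linarith)
      (by linarith [min_le_left (n : ℝ) (N / c)]) (by linarith) (by linarith) (by linarith)).trans ?_
    gcongr
    rw [show (n : ℝ) - min (n : ℝ) (N / c) - (n - g) = -(min (n : ℝ) (N / c) - g) by ring, abs_neg]
    exact hmin
  have h2 := abs_sum_rpow_sub_le hp W
    (fun v => ((Finset.univ.filter fun i => x i = v).card : ℝ))
    (fun v => ((A.filter fun i => x i = v).card : ℝ) / c) (fun _ _ => by positivity)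
    (fun _ _ => by positivity) (g := g) (θ := θ)
    (by rw [hg, card_ne_zero_eq_sum]; push_cast; rfl) hθ hθ1
    (by
      have : ∀ v ∈ W, (((A.filter fun i => x i = v).card : ℝ) / c -
          (Finset.univ.filter fun i => x i = v).card) ^ 2 =
          (((A.filter fun i => x i = v).card : ℝ) -
            c * (Finset.univ.filter fun i => x i = v).card) ^ 2 / c ^ 2 := fun v _ => by
        field_simp
      rw [Finset.sum_congr rfl this, ← Finset.sum_div, div_le_iff₀ (by positivity)]
      exact hsplit.2.trans (le_of_eq (by ring)))
  have h3 : g ^ p ≤ (n : ℝ) ^ (p - 1) * g := by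
    rw [show p = (p - 1) + 1 by ring, Real.rpow_add_one' hg0 (by linarith), add_sub_cancel_right]
    exact mul_le_mul_of_nonneg_right (Real.rpow_le_rpow hg0 hgn (by linarith)) hg0
  have h4 : p * 2 ^ (p - 1) * θ * g ^ p ≤ p * 2 ^ (p - 1) * θ * ((n : ℝ) ^ (p - 1) * g) := by
    gcongr
  rw [abs_le] at h1 h2 ⊢
  constructor <;> nlinarith [h1.1, h1.2, h2.1, h2.2]

/-- The frequencies sum to `n` and are at most `f`, so `F_p ≤ n f^(p-1) ≤ n^(p-1) f`. -/
theorem le_pow_sub_freqMoment {n : ℕ} {p : ℝ} (hp : 2 ≤ p) (x : Fin n → ℤ) {f : ℕ} (hfn : f ≤ n)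
    (hf : ∀ v, (Finset.univ.filter fun i => x i = v).card ≤ f) :
    (n : ℝ) ^ (p - 1) * (n - f) ≤ (n : ℝ) ^ p - freqMoment p x := by
  rcases Nat.eq_zero_or_pos n with rfl | hn
  · have : f = 0 := by omega
    subst this
    simp [freqMoment, Real.zero_rpow (by linarith : p ≠ 0)]
  have hn' : (0 : ℝ) < n := by exact_mod_cast hn
  have hf1 : (f : ℝ) ^ (p - 1) ≤ (n : ℝ) ^ (p - 2) * f := by
    rw [show p - 1 = (p - 2) + 1 by ring, Real.rpow_add_one' (by positivity) (by linarith)]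
    gcongr
  have h1 : freqMoment p x ≤ ∑ v ∈ Finset.univ.image x,
      ((Finset.univ.filter fun i => x i = v).card : ℝ) * ((n : ℝ) ^ (p - 2) * f) := by
    refine Finset.sum_le_sum fun v _ => ?_
    nth_rewrite 1 [show p = 1 + (p - 1) by ring]
    rw [Real.rpow_add' (by positivity) (by linarith), Real.rpow_one]
    gcongr
    refine le_trans ?_ hf1
    have := hf v
    gcongr
    linarith
  have h2 : ∑ v ∈ Finset.univ.image x, ((Finset.univ.filter fun i => x i = v).card : ℝ) = n := by
    have := Finset.card_eq_sum_card_image x (Finset.univ : Finset (Fin n))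
    rw [Finset.card_univ, Fintype.card_fin] at this
    exact_mod_cast this.symm
  rw [← Finset.sum_mul, h2] at h1
  have h3 : (n : ℝ) ^ (p - 1) = n * (n : ℝ) ^ (p - 2) := by
    rw [show p - 1 = (p - 2) + 1 by ring, Real.rpow_add_one hn'.ne', mul_comm]
  have h4 : (n : ℝ) ^ p = (n : ℝ) ^ (p - 1) * n := by
    nth_rewrite 1 [show p = (p - 1) + 1 by ring]
    rw [Real.rpow_add_one hn'.ne']
  rw [h4, h3]
  nlinarith

/-! ### Sparse recovery from power sums. -/

theorem cast_pow_mod_ne_zero {q i : ℕ} [Fact q.Prime] (hi : i + 1 < q) (r : ℕ) :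
    (i + 1) ^ r % q ≠ 0 := by
  intro h
  have h1 := (Fact.out : q.Prime).dvd_of_dvd_pow (Nat.dvd_of_mod_eq_zero h)
  have := Nat.le_of_dvd (by omega) h1
  omega

/-- A vector with at most `d` nonzero coordinates is determined by `d` consecutive power sums,
reduced coefficientwise modulo a prime. -/
theorem eq_zero_of_power_sums {q n : ℕ} [Fact q.Prime] (hn : n < q) (r d : ℕ) (z : Fin n → ℤ)
    (hz : (Finset.univ.filter fun i => z i ≠ 0).card ≤ d)
    (h : ∀ k < d, ∑ i, (((i.val + 1) ^ (r + k) % q : ℕ) : ℤ) * z i = 0) : z = 0 := by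
  set T := Finset.univ.filter fun i => z i ≠ 0 with hT
  let e : Fin T.card ≃ T := T.equivFin.symm
  let M : Matrix (Fin T.card) (Fin T.card) ℤ :=
    Matrix.of fun k j => ((((e j).1.val + 1) ^ (r + k.val) % q : ℕ) : ℤ)
  let v : Fin T.card → ZMod q := fun j => (((e j).1.val + 1 : ℕ) : ZMod q)
  -- The integer determinant is nonzero because it is so modulo `q`: there the matrix is a
  -- Vandermonde matrix with distinct nodes, its columns scaled by the nonzero powers `v j ^ r`.
  have hM : M.det ≠ 0 := by
    intro h0
    have h1 : (M.map (Int.castRingHom (ZMod q))).det = 0 := by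
      have := RingHom.map_det (Int.castRingHom (ZMod q)) M
      rw [h0, map_zero] at this
      exact this.symm
    have h2 : M.map (Int.castRingHom (ZMod q)) =
        Matrix.of fun k j => v j ^ r * (Matrix.vandermonde v).transpose k j := by
      ext k j
      simp [M, v, Matrix.vandermonde, pow_add]
    rw [h2, Matrix.det_mul_row, Matrix.det_transpose] at h1
    rcases mul_eq_zero.1 h1 with h3 | h3
    · obtain ⟨j, -, hj⟩ := Finset.prod_eq_zero_iff.1 h3
      have hj' := eq_zero_of_pow_eq_zero hj
      have := Nat.le_of_dvd (by omega) ((ZMod.natCast_eq_zero_iff _ _).1 hj')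
      omega
    · refine Matrix.det_vandermonde_ne_zero_iff.2 (fun a b hab => ?_) h3
      have := (ZMod.natCast_eq_natCast_iff' _ _ _).1 hab
      rw [Nat.mod_eq_of_lt (by omega), Nat.mod_eq_of_lt (by omega)] at this
      exact e.injective (Subtype.ext (Fin.ext (by omega)))
  have hMz : M.mulVec (fun j => z (e j)) = 0 := by
    funext k
    have h1 := h k.val (by omega)
    rw [← Finset.sum_subset (Finset.subset_univ T) fun i _ hi => by
      have : z i = 0 := by simpa [hT] using hi
      rw [this, mul_zero]] at h1
    rw [← Finset.sum_coe_sort] at h1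
    rw [Pi.zero_apply, ← h1]
    exact Fintype.sum_equiv e _ _ fun j => rfl
  have h0 := Matrix.eq_zero_of_mulVec_eq_zero hM hMz
  funext i
  by_contra hi
  have hiT : i ∈ T := by simpa [hT] using hi
  have := congrFun h0 (e.symm ⟨i, hiT⟩)
  simp only [Equiv.apply_symm_apply, Pi.zero_apply] at this
  exact hi this

/-- Sparse recovery: a vector with at most `s` nonzero coordinates, supported on the nonzero
columns of `B`, that `B` maps to `y`. -/
noncomputable def decode {d n : ℕ} (s : ℕ) (B : Matrix (Fin d) (Fin n) ℤ) (y : Fin d → ℤ) :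
    Fin n → ℤ := by
  classical exact
    if h : ∃ z : Fin n → ℤ, (Finset.univ.filter fun i => z i ≠ 0).card ≤ s ∧
        (∀ i, z i ≠ 0 → ∃ k, B k i ≠ 0) ∧ B.mulVec z = y then h.choose else 0

/-- The matrix of `d` rows of power sums with columns outside of `A` deleted, starting from
exponent `r`. -/
def IsPowerBlock (q : ℕ) {d n : ℕ} (B : Matrix (Fin d) (Fin n) ℤ) (A : Finset (Fin n)) (r : ℕ) :
    Prop :=
  ∀ k i, B k i = if i ∈ A then (((i.val + 1) ^ (r + k.val) % q : ℕ) : ℤ) else 0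

/-- Two candidates differ by a vector with at most `2 * s ≤ d` nonzero coordinates, all in `A`,
whose `d` power sums vanish. The set `A` is visible in `B` because entries of sampled columns are
never zero. -/
theorem decode_mulVec {q n d s r : ℕ} [Fact q.Prime] (hn : n < q) (hd : 2 * s ≤ d)
    {B : Matrix (Fin d) (Fin n) ℤ} {A : Finset (Fin n)} (hB : IsPowerBlock q B A r)
    {z : Fin n → ℤ} (hz : (Finset.univ.filter fun i => z i ≠ 0).card ≤ s)
    (hzA : ∀ i, z i ≠ 0 → i ∈ A) : decode s B (B.mulVec z) = z := by
  have hex : ∃ z' : Fin n → ℤ, (Finset.univ.filter fun i => z' i ≠ 0).card ≤ s ∧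
      (∀ i, z' i ≠ 0 → ∃ k, B k i ≠ 0) ∧ B.mulVec z' = B.mulVec z := by
    refine ⟨z, hz, fun i hi => ?_, rfl⟩
    have : 0 < (Finset.univ.filter fun i => z i ≠ 0).card :=
      Finset.card_pos.2 ⟨i, by simpa using hi⟩
    refine ⟨⟨0, by omega⟩, ?_⟩
    rw [hB, if_pos (hzA i hi)]
    exact_mod_cast cast_pow_mod_ne_zero (by omega) _
  have hdec : decode s B (B.mulVec z) = hex.choose := dif_pos hex
  obtain ⟨h1, h2, h3⟩ := hex.choose_spec
  rw [hdec]
  set z' := hex.choose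
  have hz'A : ∀ i, z' i ≠ 0 → i ∈ A := fun i hi => by
    obtain ⟨k, hk⟩ := h2 i hi
    by_contra hiA
    exact hk (by rw [hB, if_neg hiA])
  suffices h : z' - z = 0 from sub_eq_zero.1 h
  refine eq_zero_of_power_sums hn r d _ ?_ fun k hk => ?_
  · refine le_trans ?_ ((Nat.add_le_add h1 hz).trans (by omega))
    refine (Finset.card_le_card fun i hi => ?_).trans (Finset.card_union_le _ _)
    simp only [Finset.mem_filter, Finset.mem_univ, true_and, Finset.mem_union, Pi.sub_apply] at hi ⊢
    by_contra hcon
    push Not at hcon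
    exact hi (by rw [hcon.1, hcon.2, sub_zero])
  · have h4 : B.mulVec (z' - z) ⟨k, hk⟩ = 0 := by
      rw [Matrix.mulVec_sub, h3, sub_self, Pi.zero_apply]
    rw [← h4, Matrix.mulVec, dotProduct]
    refine Finset.sum_congr rfl fun i _ => ?_
    rw [hB]
    split
    · rfl
    · next hiA =>
      have a1 : z' i = 0 := by by_contra h; exact hiA (hz'A i h)
      have a2 : z i = 0 := by by_contra h; exact hiA (hzA i h)
      simp [a1, a2]

/-! ### Medians and amplification. -/

/-- The least value that is at least a majority of the values of `f`. -/
noncomputable def upperMedian {ℓ : ℕ} (f : Fin ℓ → ℝ) : ℝ := by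
  classical exact
    if h : ((Finset.univ.image f).filter fun y =>
        ℓ < 2 * (Finset.univ.filter fun c => f c ≤ y).card).Nonempty then
      ((Finset.univ.image f).filter fun y =>
        ℓ < 2 * (Finset.univ.filter fun c => f c ≤ y).card).min' h else 0

theorem upperMedian_mem_Icc {ℓ : ℕ} (f : Fin ℓ → ℝ) {lo hi : ℝ}
    (h : 2 * (Finset.univ.filter fun c => ¬ (lo ≤ f c ∧ f c ≤ hi)).card < ℓ) :
    lo ≤ upperMedian f ∧ upperMedian f ≤ hi := by
  classical
  set G := Finset.univ.filter fun c => lo ≤ f c ∧ f c ≤ hi with hG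
  set B := Finset.univ.filter fun c => ¬ (lo ≤ f c ∧ f c ≤ hi) with hB
  have hGB : G.card + B.card = ℓ := by
    rw [hG, hB, Finset.card_filter_add_card_filter_not, Finset.card_univ, Fintype.card_fin]
  have hGne : (G.image f).Nonempty := by
    rw [Finset.image_nonempty, ← Finset.card_pos]
    omega
  set S := (Finset.univ.image f).filter fun y =>
    ℓ < 2 * (Finset.univ.filter fun c => f c ≤ y).card with hS
  have hmax : (G.image f).max' hGne ∈ S := by
    obtain ⟨c, -, hc⟩ := Finset.mem_image.1 (Finset.max'_mem _ hGne)
    refine Finset.mem_filter.2 ⟨Finset.mem_image.2 ⟨c, Finset.mem_univ _, hc⟩, ?_⟩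
    have : G ⊆ Finset.univ.filter fun c => f c ≤ (G.image f).max' hGne := fun c hc =>
      Finset.mem_filter.2 ⟨Finset.mem_univ _, Finset.le_max' _ _ (Finset.mem_image_of_mem f hc)⟩
    have := Finset.card_le_card this
    omega
  have hSne : S.Nonempty := ⟨_, hmax⟩
  have hdef : upperMedian f = S.min' hSne := by
    rw [upperMedian, dif_pos hSne]
  rw [hdef]
  constructor
  · refine Finset.le_min' _ _ _ fun y hy => ?_
    have hy := (Finset.mem_filter.1 hy).2
    by_contra hlt
    push Not at hlt
    have : (Finset.univ.filter fun c => f c ≤ y) ⊆ B := fun c hc => by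
      have := (Finset.mem_filter.1 hc).2
      exact Finset.mem_filter.2 ⟨Finset.mem_univ _, fun h => by linarith [h.1]⟩
    have := Finset.card_le_card this
    omega
  · refine (Finset.min'_le _ _ hmax).trans ?_
    refine Finset.max'_le _ _ _ fun y hy => ?_
    obtain ⟨c, hc, rfl⟩ := Finset.mem_image.1 hy
    exact (Finset.mem_filter.1 hc).2.2

/-- Amplification: the number of tuples of which at least half of the entries are bad. -/
theorem card_majority_bad_le {Ω : Type*} [Fintype Ω] [DecidableEq Ω] (ℓ : ℕ) (Bad : Finset Ω)
    (h : 16 * Bad.card ≤ Fintype.card Ω) :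
    2 ^ ℓ * (Finset.univ.filter fun ω : Fin ℓ → Ω =>
      ℓ ≤ 2 * (Finset.univ.filter fun c => ω c ∈ Bad).card).card ≤ Fintype.card (Fin ℓ → Ω) := by
  -- Exponential moment: the total weight of `Ω` is below twice its size, while a tuple with half of
  -- its entries bad has weight at least `16^(ℓ/2) = 4^ℓ`. This leaves a fraction `2^(-ℓ)`.
  let wt : Ω → ℕ := fun a => if a ∈ Bad then 16 else 1
  have h1 : ∑ ω : Fin ℓ → Ω, ∏ c, wt (ω c) = (∑ a, wt a) ^ ℓ := by
    rw [Finset.sum_pow', Fintype.piFinset_univ]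
  have h2 : ∑ a, wt a ≤ 2 * Fintype.card Ω := by
    have : ∑ a, wt a = 15 * Bad.card + Fintype.card Ω := by
      have e : ∀ a, wt a = 15 * (if a ∈ Bad then 1 else 0) + 1 := fun a => by
        simp only [wt]; split <;> rfl
      simp only [e, Finset.sum_add_distrib, ← Finset.mul_sum]
      simp
    omega
  set S := Finset.univ.filter fun ω : Fin ℓ → Ω =>
      ℓ ≤ 2 * (Finset.univ.filter fun c => ω c ∈ Bad).card with hS
  have h3 : S.card * 4 ^ ℓ ≤ ∑ ω : Fin ℓ → Ω, ∏ c, wt (ω c) := by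
    rw [← smul_eq_mul, ← Finset.sum_const]
    refine (Finset.sum_le_sum fun ω hω => ?_).trans
      (Finset.sum_le_sum_of_subset (Finset.subset_univ S))
    have hω := (Finset.mem_filter.1 hω).2
    have : ∏ c, wt (ω c) = 16 ^ (Finset.univ.filter fun c => ω c ∈ Bad).card := by
      simp only [wt]
      rw [Finset.prod_ite, Finset.prod_const, Finset.prod_const_one, mul_one]
    rw [this, show 16 = 4 ^ 2 by norm_num, ← pow_mul]
    exact Nat.pow_le_pow_right (by norm_num) hω
  have h4 : S.card * 4 ^ ℓ ≤ (2 * Fintype.card Ω) ^ ℓ := by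
    rw [h1] at h3
    exact h3.trans (Nat.pow_le_pow_left h2 ℓ)
  rw [mul_pow, show 4 = 2 * 2 by norm_num, mul_pow] at h4
  rw [Fintype.card_fun, Fintype.card_fin]
  have : 0 < 2 ^ ℓ := by positivity
  nlinarith

/-! ### Decoding a single copy. -/

/-- The value of the reference coordinate, computed from the last block of a copy. -/
def refValue {d n : ℕ} (B : Matrix (Fin d) (Fin n) ℤ) (y : Fin d → ℤ) : ℤ :=
  (∑ k, y k) / ∑ k, B.mulVec 1 k

/-- The sampled part of `x - v` recovered from one block. -/
noncomputable def levelVector {d n : ℕ} (s : ℕ) (v : ℤ) (B : Matrix (Fin d) (Fin n) ℤ)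
    (y : Fin d → ℤ) : Fin n → ℤ :=
  decode s B (y - B.mulVec fun _ => v)

/-- The sparsest level at which at least `τ` nonzero coordinates are recovered, or level `0`. -/
noncomputable def chosenLevel {n : ℕ} (ℓ τ : ℕ) (z : ℕ → Fin n → ℤ) : ℕ := by
  classical
  exact Nat.findGreatest
    (fun j => j < ℓ ∧ τ ≤ (Finset.univ.filter fun i => z j i ≠ 0).card) ℓ

/-- The sampling rate of a level. -/
noncomputable def rate (q j : ℕ) : ℝ := ((q / 2 ^ j : ℕ) : ℝ) / q

/-- The answer of one copy of the sketch. -/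
noncomputable def copyAnswer (p : ℝ) (q ℓ s τ : ℕ) {d n : ℕ} (B : ℕ → Matrix (Fin d) (Fin n) ℤ)
    (y : ℕ → Fin d → ℤ) : ℝ :=
  let z := fun j => levelVector s (refValue (B ℓ) (y ℓ)) (B j) (y j)
  estimate p (rate q (chosenLevel ℓ τ z)) (z (chosenLevel ℓ τ z))

/-- Only column `i₀` is nonzero and its entries are positive, so the integer division is exact with
a nonzero divisor. -/
theorem refValue_eq {q n d r : ℕ} [Fact q.Prime] (hn : n < q) (hd : 0 < d) {i₀ : Fin n}
    {B : Matrix (Fin d) (Fin n) ℤ} (hB : IsPowerBlock q B {i₀} r) (x : Fin n → ℤ) :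
    refValue B (B.mulVec x) = x i₀ := by
  have h1 : ∀ (x : Fin n → ℤ) k, B.mulVec x k = B k i₀ * x i₀ := by
    intro x k
    rw [Matrix.mulVec, dotProduct, Finset.sum_eq_single i₀]
    · intro i _ hi
      rw [hB, if_neg (by simpa using hi), zero_mul]
    · simp
  have h2 : ∀ k, 0 < B k i₀ := fun k => by
    rw [hB, if_pos (by simp)]
    exact_mod_cast Nat.pos_of_ne_zero (cast_pow_mod_ne_zero (by omega) _)
  have h3 : 0 < ∑ k, B k i₀ :=
    Finset.sum_pos (fun k _ => h2 k) ⟨⟨0, hd⟩, Finset.mem_univ _⟩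
  simp only [refValue, h1, Pi.one_apply, mul_one]
  rw [← Finset.sum_mul, Int.mul_ediv_cancel_left _ h3.ne']

theorem card_restrict_ne_zero {n : ℕ} (A : Finset (Fin n)) (x : Fin n → ℤ) :
    (Finset.univ.filter fun i => restrict A x i ≠ 0) = A.filter fun i => x i ≠ 0 := by
  ext i; simp [restrict]

theorem levelVector_eq {q n d r s : ℕ} [Fact q.Prime] (hn : n < q) (hd : 2 * s ≤ d)
    {B : Matrix (Fin d) (Fin n) ℤ} {A : Finset (Fin n)} (hB : IsPowerBlock q B A r)
    (x : Fin n → ℤ) (v : ℤ) (hs : (A.filter fun i => x i - v ≠ 0).card ≤ s) :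
    levelVector s v B (B.mulVec x) = restrict A fun i => x i - v := by
  have h1 : B.mulVec x - (B.mulVec fun _ => v) = B.mulVec (restrict A fun i => x i - v) := by
    rw [← Matrix.mulVec_sub]
    funext k
    rw [Matrix.mulVec, Matrix.mulVec, dotProduct, dotProduct]
    refine Finset.sum_congr rfl fun i _ => ?_
    rw [hB, restrict]
    split <;> simp
  rw [levelVector, h1]
  refine decode_mulVec hn hd hB ?_ fun i hi => ?_
  · rw [card_restrict_ne_zero]; exact hs
  · by_contra h
    exact hi (by rw [restrict, if_neg h])

theorem rate_nonneg (q j : ℕ) : 0 ≤ rate q j := by unfold rate; positivity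

theorem rate_zero {q : ℕ} (hq : 0 < q) : rate q 0 = 1 := by
  have : (q : ℝ) ≠ 0 := by positivity
  simp [rate, this]

theorem rate_le {q : ℕ} (hq : 0 < q) (j : ℕ) : rate q j * 2 ^ j ≤ 1 := by
  have hq' : (0 : ℝ) < q := by exact_mod_cast hq
  have : ((q / 2 ^ j : ℕ) : ℝ) * 2 ^ j ≤ q := by exact_mod_cast Nat.div_mul_le_self q (2 ^ j)
  rw [rate, div_mul_eq_mul_div, div_le_one hq']
  exact this

theorem rate_le_succ {q : ℕ} (hq : 0 < q) (j : ℕ) : rate q j ≤ 2 * rate q (j + 1) + 1 / q := by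
  have hq' : (0 : ℝ) < q := by exact_mod_cast hq
  have : q / 2 ^ j ≤ 2 * (q / 2 ^ (j + 1)) + 1 := by
    rw [pow_succ, ← Nat.div_div_eq_div_mul]
    omega
  have : ((q / 2 ^ j : ℕ) : ℝ) ≤ 2 * ((q / 2 ^ (j + 1) : ℕ) : ℝ) + 1 := by exact_mod_cast this
  rw [rate, rate, mul_div_assoc', ← add_div]
  gcongr

theorem abs_card_sub_le {n : ℕ} {A : Finset (Fin n)} {c e : ℝ} {x : Fin n → ℤ} (he : 0 ≤ e)
    (h : deviation A c x ≤ e ^ 2) : |((A.filter fun i => x i ≠ 0).card : ℝ) -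
      c * (Finset.univ.filter fun i => x i ≠ 0).card| ≤ e := by
  refine abs_le_of_sq_le_sq (le_trans ?_ h) he
  exact le_add_of_nonneg_right (Finset.sum_nonneg fun _ _ => sq_nonneg _)

/-- If the samples of all levels are representative, a level exists from which on all samples are
sparse, and which is not too sparse. -/
theorem exists_level {n q ℓ τ : ℕ} (hn : n < q) (hℓ : 0 < ℓ) (hτ : 0 < τ) (hnℓ : n ≤ 2 ^ (ℓ - 1))
    {θ : ℝ} (hθ : 0 ≤ θ) (hθ1 : θ ≤ 1 / 4) (A : ℕ → Finset (Fin n)) (x : Fin n → ℤ)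
    (hdev : ∀ j < ℓ, deviation (A j) (rate q j) x ≤
      (θ * (rate q j * (Finset.univ.filter fun i => x i ≠ 0).card + τ)) ^ 2) :
    ∃ j₀ < ℓ, (∀ j, j₀ ≤ j → j < ℓ → ((A j).filter fun i => x i ≠ 0).card ≤ 16 * τ) ∧
      (j₀ = 0 ∨ τ ≤ ((A j₀).filter fun i => x i ≠ 0).card) := by
  classical
  have hq : 0 < q := by omega
  have hq' : (0 : ℝ) < q := by exact_mod_cast hq
  have hτ1 : (1 : ℝ) ≤ τ := by exact_mod_cast hτ
  set g : ℕ := (Finset.univ.filter fun i => x i ≠ 0).card with hg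
  have hgn : g ≤ n := by
    have := Finset.card_le_univ (Finset.univ.filter fun i => x i ≠ 0)
    rwa [Fintype.card_fin] at this
  have hgn' : (g : ℝ) ≤ n := by exact_mod_cast hgn
  have hnq' : (n : ℝ) ≤ q := by exact_mod_cast hn.le
  rcases Nat.lt_or_ge g (2 * τ) with hsmall | hbig
  · refine ⟨0, hℓ, fun j _ _ => ?_, Or.inl rfl⟩
    have : ((A j).filter fun i => x i ≠ 0).card ≤ g :=
      Finset.card_le_card (Finset.filter_subset_filter _ (Finset.subset_univ _))
    omega
  have hN : ∀ j < ℓ, |(((A j).filter fun i => x i ≠ 0).card : ℝ) - rate q j * g| ≤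
      θ * (rate q j * g + τ) := fun j hj =>
    abs_card_sub_le (mul_nonneg hθ (add_nonneg (mul_nonneg (rate_nonneg q j) (by positivity))
      (by positivity))) (hdev j hj)
  have hμ0 : ∀ j, 0 ≤ rate q j * g := fun j => mul_nonneg (rate_nonneg q j) (by positivity)
  set P : ℕ → Prop := fun j => (2 * τ : ℝ) ≤ rate q j * g with hP
  have hP0 : P 0 := by
    simp only [hP, rate_zero hq, one_mul]; exact_mod_cast hbig
  -- The last level whose expected sample has size at least `2 τ`. Later levels expect fewer than `2
  -- τ`; level `j₀` itself expects at most `2 * 2 τ + 1 ≤ 5 τ`, the `1` coming from rounding the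
  -- threshold.
  set j₀ := Nat.findGreatest P (ℓ - 1) with hj₀
  have hPj₀ : P j₀ := Nat.findGreatest_spec (Nat.zero_le _) hP0
  have hlast : ¬ P (ℓ - 1) := by
    simp only [hP, not_le]
    have h1 := rate_le hq (ℓ - 1)
    have h2 : (n : ℝ) ≤ 2 ^ (ℓ - 1) := by exact_mod_cast hnℓ
    have h3 : rate q (ℓ - 1) * g ≤ rate q (ℓ - 1) * 2 ^ (ℓ - 1) :=
      mul_le_mul_of_nonneg_left (hgn'.trans h2) (rate_nonneg _ _)
    linarith
  have hle : j₀ ≤ ℓ - 1 := Nat.findGreatest_le _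
  have hlt : j₀ < ℓ - 1 := lt_of_le_of_ne hle fun h => hlast (h ▸ hPj₀)
  have hnot : ∀ j, j₀ < j → j < ℓ → rate q j * g < 2 * τ := fun j h1 h2 =>
    not_le.1 (Nat.findGreatest_is_greatest h1 (by omega))
  have hμj₀ : rate q j₀ * g ≤ 5 * τ := by
    have h1 := hnot (j₀ + 1) (by omega) (by omega)
    have h2 : rate q j₀ * g ≤ (2 * rate q (j₀ + 1) + 1 / q) * g :=
      mul_le_mul_of_nonneg_right (rate_le_succ hq j₀) (by positivity)
    have h3 : 1 / (q : ℝ) * g ≤ 1 := by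
      rw [one_div, inv_mul_le_iff₀ hq']; linarith
    nlinarith
  refine ⟨j₀, by omega, fun j h1 h2 => ?_, Or.inr ?_⟩
  · have h3 : rate q j * g ≤ 5 * τ := by
      rcases h1.eq_or_lt with rfl | h
      · exact hμj₀
      · linarith [hnot j h h2]
    have h4 := (abs_le.1 (hN j h2)).2
    have h5 : θ * (rate q j * g + τ) ≤ 1 / 4 * (rate q j * g + τ) :=
      mul_le_mul_of_nonneg_right hθ1 (by linarith [hμ0 j])
    have : (((A j).filter fun i => x i ≠ 0).card : ℝ) ≤ (16 * τ : ℕ) := by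
      push_cast
      linarith
    exact_mod_cast this
  · have h4 := (abs_le.1 (hN j₀ (by omega))).1
    have h5 : θ * (rate q j₀ * g + τ) ≤ 1 / 4 * (rate q j₀ * g + τ) :=
      mul_le_mul_of_nonneg_right hθ1 (by linarith [hμ0 j₀])
    have h6 : (2 * τ : ℝ) ≤ rate q j₀ * g := hPj₀
    have : (τ : ℝ) ≤ (((A j₀).filter fun i => x i ≠ 0).card : ℝ) := by linarith
    exact_mod_cast this

theorem deviation_univ_one {n : ℕ} (x : Fin n → ℤ) : deviation Finset.univ 1 x = 0 := by
  simp [deviation]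

/-- Accuracy of a copy whose samples are representative. -/
theorem abs_copyAnswer_sub_le {p : ℝ} (hp : 2 ≤ p) {n q ℓ τ d : ℕ} [Fact q.Prime] (hn : n < q)
    (hℓ : 0 < ℓ) (hτ : 0 < τ) (hnℓ : n ≤ 2 ^ (ℓ - 1)) (hd : 2 * (16 * τ) ≤ d)
    {θ : ℝ} (hθ : 0 ≤ θ) (hθ1 : θ ≤ 1 / 4) (A : ℕ → Finset (Fin n)) (hA : A 0 = Finset.univ)
    (r : ℕ → ℕ) (B : ℕ → Matrix (Fin d) (Fin n) ℤ) (hB : ∀ j < ℓ, IsPowerBlock q (B j) (A j) (r j))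
    (i₀ : Fin n) (hBℓ : IsPowerBlock q (B ℓ) {i₀} (r ℓ)) (x : Fin n → ℤ)
    (hdev : ∀ j < ℓ, deviation (A j) (rate q j) (fun i => x i - x i₀) ≤
      (θ * (rate q j * (Finset.univ.filter fun i => x i - x i₀ ≠ 0).card + τ)) ^ 2) :
    |copyAnswer p q ℓ (16 * τ) τ B (fun j => (B j).mulVec x) - ((n : ℝ) ^ p - freqMoment p x)| ≤
      p * (1 + 2 ^ (p - 1)) * (3 * θ) *
        ((n : ℝ) ^ (p - 1) * (Finset.univ.filter fun i => x i - x i₀ ≠ 0).card) := by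
  classical
  have hq : 0 < q := by omega
  obtain ⟨j₀, hj₀, hsparse, hj₀'⟩ := exists_level hn hℓ hτ hnℓ hθ hθ1 A _ hdev
  have hv : refValue (B ℓ) ((B ℓ).mulVec x) = x i₀ := refValue_eq hn (by omega) hBℓ x
  have hz : ∀ j, j₀ ≤ j → j < ℓ → levelVector (16 * τ) (x i₀) (B j) ((B j).mulVec x) =
      restrict (A j) fun i => x i - x i₀ := fun j h1 h2 =>
    levelVector_eq hn hd (hB j h2) x (x i₀) (hsparse j h1 h2)
  simp only [copyAnswer, hv]
  set z := fun j => levelVector (16 * τ) (x i₀) (B j) ((B j).mulVec x) with hzdef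
  set J := chosenLevel ℓ τ z with hJ
  set Q : ℕ → Prop := fun j => j < ℓ ∧ τ ≤ (Finset.univ.filter fun i => z j i ≠ 0).card with hQ
  have hJQ : J = Nat.findGreatest Q ℓ := rfl
  -- Levels before `j₀` may be too dense and decode to arbitrary vectors. Taking the greatest
  -- admissible level makes them irrelevant.
  have hJge : j₀ ≤ J := by
    rcases hj₀' with rfl | h
    · exact Nat.zero_le _
    · rw [hJQ]
      refine Nat.le_findGreatest hj₀.le ⟨hj₀, ?_⟩
      rw [show z j₀ = _ from hz j₀ le_rfl hj₀, card_restrict_ne_zero]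
      exact h
  have hJQ' : J ≠ 0 → Q J := fun h => Nat.findGreatest_of_ne_zero hJQ.symm h
  have hJℓ : J < ℓ := by
    by_cases h : J = 0
    · omega
    · exact (hJQ' h).1
  rw [hz J hJge hJℓ, ← freqMoment_sub_const p x (x i₀)]
  set g : ℝ := ((Finset.univ.filter fun i => x i - x i₀ ≠ 0).card : ℝ) with hg
  have hg0 : 0 ≤ g := by positivity
  -- Level 0 keeps every coordinate at rate 1, so its deviation is zero and no lower bound on the
  -- sample size is needed.
  by_cases hJ0 : J = 0
  · rw [hJ0, rate_zero hq, hA]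
    refine abs_estimate_sub_le hp _ one_pos (by linarith) (by linarith) _ ?_
    rw [deviation_univ_one]
    positivity
  · have hNτ := (hJQ' hJ0).2
    rw [show z J = _ from hz J hJge hJℓ, card_restrict_ne_zero] at hNτ
    have hNτ' : (τ : ℝ) ≤ (((A J).filter fun i => x i - x i₀ ≠ 0).card : ℝ) := by
      exact_mod_cast hNτ
    have hτ1 : (1 : ℝ) ≤ τ := by exact_mod_cast hτ
    have hμ0 : 0 ≤ rate q J * g := mul_nonneg (rate_nonneg q J) hg0
    have h1 := (abs_le.1 (abs_card_sub_le (mul_nonneg hθ (by linarith)) (hdev J hJℓ))).2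
    -- At least `τ` recovered coordinates force the expected number `μ = rate q J * g` to satisfy `τ
    -- ≤ 2 μ`. The tolerance `θ (μ + τ)` is then at most `3 θ μ`, hence the factor 3.
    have h5 : θ * (rate q J * g + τ) ≤ 1 / 4 * (rate q J * g + τ) :=
      mul_le_mul_of_nonneg_right hθ1 (by linarith)
    have h6 : (τ : ℝ) ≤ 2 * (rate q J * g) := by linarith
    have hrate : 0 < rate q J := by
      rcases (rate_nonneg q J).eq_or_lt with h | h
      · rw [← h] at h6; linarith
      · exact h
    refine abs_estimate_sub_le hp _ hrate (by linarith) (by linarith) _ ((hdev J hJℓ).trans ?_)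
    refine pow_le_pow_left₀ (mul_nonneg hθ (by linarith)) ?_ 2
    nlinarith

/-! ### Seeds and the arrangement of the rows in copies and blocks. -/

/-- The random seed of one copy: a hash function and a reference coordinate. -/
abbrev CopySeed (q n : ℕ) : Type := (ZMod q × ZMod q) × Fin n

/-- The hash function of block `j` of a copy; the last block selects the reference coordinate. -/
def blockHash {q n : ℕ} (ℓ : ℕ) (σ : CopySeed q n) (j : ℕ) : ZMod q × ZMod q :=
  if j < ℓ then σ.1 else (1, -((σ.2.val : ℕ) : ZMod q))

/-- The hash threshold of block `j` of a copy. -/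
def blockThreshold (q ℓ j : ℕ) : ℕ := if j < ℓ then q / 2 ^ j else 1

/-- The coordinates sampled in block `j`. -/
def blockSet {q n : ℕ} (ℓ : ℕ) (σ : CopySeed q n) (j : ℕ) : Finset (Fin n) :=
  hashSet n q (blockThreshold q ℓ j) (blockHash ℓ σ j).1.val (blockHash ℓ σ j).2.val

/-- The hash function of row `r`, for blocks of `d` rows and `ℓ + 1` blocks for each of `ℓ`
copies. -/
def rowHash {q n ℓ : ℕ} [NeZero ℓ] (d : ℕ) (ω : Fin ℓ → CopySeed q n) (r : ℕ) : ZMod q × ZMod q :=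
  blockHash ℓ (ω (Fin.ofNat ℓ (r / ((ℓ + 1) * d)))) (r / d % (ℓ + 1))

/-- The hash threshold of row `r`. -/
def rowThreshold (q ℓ d r : ℕ) : ℕ := blockThreshold q ℓ (r / d % (ℓ + 1))

/-- The first row of block `j` of copy `c`. -/
def blockStart (ℓ d c j : ℕ) : ℕ := (c * (ℓ + 1) + j) * d

/-- The number of rows. -/
def rowCount (ℓ d : ℕ) : ℕ := ℓ * ((ℓ + 1) * d)

theorem blockStart_add_lt {ℓ d c j k : ℕ} (hc : c < ℓ) (hj : j ≤ ℓ) (hk : k < d) :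
    blockStart ℓ d c j + k < rowCount ℓ d := by
  unfold blockStart rowCount
  calc (c * (ℓ + 1) + j) * d + k < (c * (ℓ + 1) + j) * d + d := by omega
    _ = (c * (ℓ + 1) + j + 1) * d := by ring
    _ ≤ (ℓ * (ℓ + 1)) * d := Nat.mul_le_mul_right _ (by nlinarith)
    _ = _ := by ring

theorem blockStart_div {ℓ d c j k : ℕ} (hj : j ≤ ℓ) (hk : k < d) :
    (blockStart ℓ d c j + k) / ((ℓ + 1) * d) = c ∧
      (blockStart ℓ d c j + k) / d % (ℓ + 1) = j := by
  have h1 : (blockStart ℓ d c j + k) / d = c * (ℓ + 1) + j := by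
    unfold blockStart
    rw [mul_comm, Nat.mul_add_div (by omega), Nat.div_eq_of_lt hk, add_zero]
  constructor
  · rw [mul_comm (ℓ + 1), ← Nat.div_div_eq_div_mul, h1, mul_comm, Nat.mul_add_div (by omega),
      Nat.div_eq_of_lt (by omega), add_zero]
  · rw [h1, mul_comm, Nat.mul_add_mod, Nat.mod_eq_of_lt (by omega)]

/-- Block `j` of copy `c` of a family indexed by the rows. -/
def blockOf {α : Type*} [Zero α] (ℓ d c : ℕ) (f : Fin (rowCount ℓ d) → α) (j : ℕ) : Fin d → α :=
  fun k => if h : blockStart ℓ d c j + k.val < rowCount ℓ d then f ⟨_, h⟩ else 0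

theorem blockOf_mulVec {ℓ d n : ℕ} (c j : ℕ) (S : Matrix (Fin (rowCount ℓ d)) (Fin n) ℤ)
    (x : Fin n → ℤ) :
    blockOf ℓ d c (S.mulVec x) j = Matrix.mulVec (blockOf ℓ d c (α := Fin n → ℤ) S j) x := by
  funext k
  by_cases h : blockStart ℓ d c j + k.val < rowCount ℓ d
  · simp [Matrix.mulVec, blockOf, h]
  · simp [Matrix.mulVec, blockOf, h]

/-- The sketching matrix determined by a seed. -/
def seedMatrix {q n ℓ : ℕ} [NeZero ℓ] (d : ℕ) (ω : Fin ℓ → CopySeed q n) :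
    Matrix (Fin (rowCount ℓ d)) (Fin n) ℤ :=
  paramMatrix n q (rowCount ℓ d) (fun r => (rowHash d ω r).1.val) (fun r => (rowHash d ω r).2.val)
    (rowThreshold q ℓ d)

/-- The exponent of a row is its global index, so one running power serves the whole matrix; each
block then consists of consecutive power sums starting at its own offset. -/
theorem isPowerBlock_blockOf {q n ℓ d j : ℕ} [NeZero ℓ] (ω : Fin ℓ → CopySeed q n) (c : Fin ℓ)
    (hj : j ≤ ℓ) : IsPowerBlock q (blockOf ℓ d c (α := Fin n → ℤ) (seedMatrix d ω) j)
      (blockSet ℓ (ω c) j) (blockStart ℓ d c j) := by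
  intro k i
  obtain ⟨h1, h2⟩ := blockStart_div (c := c.val) hj k.2
  have hc : Fin.ofNat ℓ c.val = c := by simp
  simp only [blockOf, dif_pos (blockStart_add_lt c.2 hj k.2), seedMatrix, paramMatrix, entry,
    rowHash, rowThreshold, h1, h2, hc, blockSet, hashSet, Finset.mem_filter, Finset.mem_univ,
    true_and]
  split <;> simp

/-- The hash value of `i` is `i - i₀` modulo `q`, which is below the threshold 1 only for `i = i₀`.
The program thus treats this block like any other. -/
theorem blockSet_last {q n ℓ : ℕ} [Fact q.Prime] (hn : n < q) (σ : CopySeed q n) :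
    blockSet ℓ σ ℓ = {σ.2} := by
  ext i
  simp only [blockSet, hashSet, blockThreshold, blockHash, lt_irrefl, if_false, Finset.mem_filter,
    Finset.mem_univ, true_and, Finset.mem_singleton, Nat.lt_one_iff]
  rw [← hash_val, ZMod.val_eq_zero, one_mul, add_neg_eq_zero, ZMod.natCast_eq_natCast_iff',
    Nat.mod_eq_of_lt (by omega), Nat.mod_eq_of_lt (by omega)]
  exact Fin.ext_iff.symm

theorem blockSet_level {q n ℓ j : ℕ} (hj : j < ℓ) (σ : CopySeed q n) :
    blockSet ℓ σ j = hashSet n q (q / 2 ^ j) σ.1.1.val σ.1.2.val := by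
  simp [blockSet, blockThreshold, blockHash, hj]

theorem blockSet_zero {q n ℓ : ℕ} [NeZero q] (hℓ : 0 < ℓ) (σ : CopySeed q n) :
    blockSet ℓ σ 0 = Finset.univ := by
  rw [blockSet_level hℓ, hashSet, Finset.filter_eq_self]
  intro i _
  simpa using Nat.mod_lt _ (NeZero.pos q)

/-! ### Failure probability of a copy and accuracy of the median. -/

/-- The answer to a query: the median of the answers of the copies. -/
noncomputable def medianAnswer (p : ℝ) (q n ℓ τ d : ℕ)
    (S : Matrix (Fin (rowCount ℓ d)) (Fin n) ℤ) (y : Fin (rowCount ℓ d) → ℤ) : ℝ :=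
  upperMedian fun c : Fin ℓ => copyAnswer p q ℓ (16 * τ) τ
    (fun j => blockOf ℓ d c (α := Fin n → ℤ) S j) (fun j => blockOf ℓ d c y j)

/-- The number of coordinates that differ from coordinate `i₀`. -/
def diffCount {n : ℕ} (x : Fin n → ℤ) (i₀ : Fin n) : ℕ :=
  (Finset.univ.filter fun i => x i - x i₀ ≠ 0).card

/-- The sample of level `j` represents the coordinates of `x` that differ from the reference. -/
def Representative {q n : ℕ} (τ : ℕ) (θ : ℝ) (x : Fin n → ℤ) (i₀ : Fin n) (j : ℕ)
    (s : ZMod q × ZMod q) : Prop :=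
  deviation (hashSet n q (q / 2 ^ j) s.1.val s.2.val) (rate q j) (fun i => x i - x i₀) ≤
    (θ * (rate q j * diffCount x i₀ + τ)) ^ 2

theorem abs_copyAnswer_seed_le {p : ℝ} (hp : 2 ≤ p) {n q ℓ τ d : ℕ} [Fact q.Prime] [NeZero ℓ]
    (hn : n < q) (hτ : 0 < τ) (hnℓ : n ≤ 2 ^ (ℓ - 1)) (hd : 2 * (16 * τ) ≤ d)
    {θ : ℝ} (hθ : 0 ≤ θ) (hθ1 : θ ≤ 1 / 4) (x : Fin n → ℤ) (ω : Fin ℓ → CopySeed q n) (c : Fin ℓ)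
    (h : ∀ j < ℓ, Representative τ θ x (ω c).2 j (ω c).1) :
    |copyAnswer p q ℓ (16 * τ) τ (fun j => blockOf ℓ d c (α := Fin n → ℤ) (seedMatrix d ω) j)
      (fun j => blockOf ℓ d c ((seedMatrix d ω).mulVec x) j) - ((n : ℝ) ^ p - freqMoment p x)| ≤
      p * (1 + 2 ^ (p - 1)) * (3 * θ) * ((n : ℝ) ^ (p - 1) * diffCount x (ω c).2) := by
  have hℓ : 0 < ℓ := NeZero.pos ℓ
  have := abs_copyAnswer_sub_le hp hn hℓ hτ hnℓ hd hθ hθ1 (blockSet ℓ (ω c))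
    (blockSet_zero hℓ _) (fun j => blockStart ℓ d c j)
    (fun j => blockOf ℓ d c (α := Fin n → ℤ) (seedMatrix d ω) j)
    (fun j hj => isPowerBlock_blockOf ω c hj.le) (ω c).2
    (blockSet_last hn (ω c) ▸ isPowerBlock_blockOf ω c le_rfl) x
    (fun j hj => by rw [blockSet_level hj]; exact h j hj)
  simp only [blockOf_mulVec]
  exact this

/-- The seeds of a copy for which it may be inaccurate. -/
noncomputable def badSeeds {n : ℕ} (q ℓ τ : ℕ) (θ : ℝ) [NeZero q] (x : Fin n → ℤ) (f : ℕ) :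
    Finset (CopySeed q n) := by
  classical
  exact Finset.univ.filter fun σ =>
    (∃ j < ℓ, ¬ Representative τ θ x σ.2 j σ.1) ∨ 32 * (n - f) < diffCount x σ.2

/-- Chebyshev: with expected size `μ`, the failing fraction is at most `2 μ / (θ (μ + τ))^2 ≤ 2 /
(θ^2 τ) ≤ 1 / (32 ℓ)`, by `μ τ ≤ (μ + τ)^2`. The summand `τ` in the tolerance covers levels with a
tiny sample. -/
theorem card_not_representative_le {n q τ ℓ : ℕ} [Fact q.Prime] (hn : n ≤ q) (hτ : 0 < τ) {θ : ℝ}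
    (hθτ : 64 * ℓ ≤ θ ^ 2 * τ) (x : Fin n → ℤ) (i₀ : Fin n) (j : ℕ)
    [DecidablePred fun s : ZMod q × ZMod q => ¬ Representative τ θ x i₀ j s] :
    32 * ℓ * (Finset.univ.filter fun s : ZMod q × ZMod q => ¬ Representative τ θ x i₀ j s).card ≤
      q ^ 2 := by
  set Z := Finset.univ.filter fun s : ZMod q × ZMod q => ¬ Representative τ θ x i₀ j s with hZ
  set μ : ℝ := rate q j * diffCount x i₀ with hμ
  have hμ0 : 0 ≤ μ := mul_nonneg (rate_nonneg q j) (by positivity)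
  have hτ' : (0 : ℝ) < τ := by exact_mod_cast hτ
  have h1 := sum_deviation_le hn (Nat.div_le_self q (2 ^ j)) fun i => x i - x i₀
  have h2 : (Z.card : ℝ) * (θ * (μ + τ)) ^ 2 ≤ q ^ 2 * (2 * μ) := by
    refine le_trans ?_ h1
    rw [← nsmul_eq_mul, ← Finset.sum_const]
    refine (Finset.sum_le_sum fun s hs => ?_).trans
      (Finset.sum_le_sum_of_subset_of_nonneg (Finset.subset_univ Z) fun s _ _ => ?_)
    · have := (Finset.mem_filter.1 hs).2
      exact (not_le.1 this).le
    · exact add_nonneg (sq_nonneg _) (Finset.sum_nonneg fun _ _ => sq_nonneg _)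
  have h3 : (Z.card : ℝ) * (64 * ℓ) * (μ + τ) ^ 2 ≤ 2 * q ^ 2 * (μ + τ) ^ 2 :=
    calc (Z.card : ℝ) * (64 * ℓ) * (μ + τ) ^ 2 ≤ Z.card * (θ ^ 2 * τ) * (μ + τ) ^ 2 := by gcongr
      _ = (Z.card * (θ * (μ + τ)) ^ 2) * τ := by ring
      _ ≤ q ^ 2 * (2 * μ) * τ := by gcongr
      _ = 2 * q ^ 2 * (μ * τ) := by ring
      _ ≤ 2 * q ^ 2 * (μ + τ) ^ 2 := by
        gcongr
        nlinarith
  have h4 := le_of_mul_le_mul_right h3 (by positivity)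
  have h5 : ((32 * ℓ * Z.card : ℕ) : ℝ) ≤ (q ^ 2 : ℕ) := by
    push_cast
    linarith
  exact_mod_cast h5

theorem exists_mode {n : ℕ} [NeZero n] (x : Fin n → ℤ) :
    ∃ i₁ : Fin n, ∀ v, (Finset.univ.filter fun i => x i = v).card ≤
      (Finset.univ.filter fun i => x i = x i₁).card := by
  obtain ⟨i₁, -, h⟩ := Finset.exists_max_image (Finset.univ : Finset (Fin n))
    (fun i₁ => (Finset.univ.filter fun i => x i = x i₁).card) ⟨0, Finset.mem_univ _⟩
  refine ⟨i₁, fun v => ?_⟩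
  by_cases hv : ∃ i, x i = v
  · obtain ⟨i, rfl⟩ := hv
    exact h i (Finset.mem_univ _)
  · push Not at hv
    rw [Finset.filter_false_of_mem fun i _ => hv i]
    simp

theorem card_eq_add_diffCount {n : ℕ} (x : Fin n → ℤ) (i₀ : Fin n) :
    (Finset.univ.filter fun i => x i = x i₀).card + diffCount x i₀ = n := by
  have := Finset.card_filter_add_card_filter_not (s := (Finset.univ : Finset (Fin n)))
    (fun i => x i = x i₀)
  rw [Finset.card_univ, Fintype.card_fin] at this
  rw [diffCount]
  simpa [sub_eq_zero] using this

/-- A bad reference has a value different from `x i₁`, so there are at most `diffCount x i₁` of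
them. If that exceeds `n / 32`, none is bad, since `diffCount` never exceeds `n`. -/
theorem card_bad_reference_le {n : ℕ} (x : Fin n → ℤ) (i₁ : Fin n) :
    32 * (Finset.univ.filter fun i₀ : Fin n => 32 * diffCount x i₁ < diffCount x i₀).card ≤ n := by
  have hle : ∀ i₀, diffCount x i₀ ≤ n := fun i₀ => by
    have := card_eq_add_diffCount x i₀
    omega
  rcases Nat.lt_or_ge n (32 * diffCount x i₁) with h | h
  · rw [Finset.filter_false_of_mem fun i₀ _ => by have := hle i₀; omega]
    simp
  · refine le_trans (Nat.mul_le_mul_left _ (Finset.card_le_card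
      (t := Finset.univ.filter fun i => x i - x i₁ ≠ 0) fun i hi => ?_)) h
    have hi := (Finset.mem_filter.1 hi).2
    refine Finset.mem_filter.2 ⟨Finset.mem_univ _, fun h0 => ?_⟩
    have : x i = x i₁ := by linarith
    rw [diffCount, diffCount, this] at hi
    omega

/-- Union bound: `ℓ` levels at `1 / (32 ℓ)` each, plus `1 / 32` for the reference. -/
theorem card_badSeeds_le {n q τ ℓ : ℕ} [Fact q.Prime] [NeZero q] (hn : n ≤ q) (hτ : 0 < τ) {θ : ℝ}
    (hθτ : 64 * ℓ ≤ θ ^ 2 * τ) (x : Fin n → ℤ) (i₁ : Fin n) :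
    16 * (badSeeds q ℓ τ θ x (Finset.univ.filter fun i => x i = x i₁).card).card ≤
      Fintype.card (CopySeed q n) := by
  classical
  have hf : n - (Finset.univ.filter fun i => x i = x i₁).card = diffCount x i₁ := by
    have := card_eq_add_diffCount x i₁
    omega
  set R : Finset (Fin n) :=
    Finset.univ.filter fun i₀ : Fin n => 32 * diffCount x i₁ < diffCount x i₀ with hR
  set Z : Fin n → ℕ → Finset (ZMod q × ZMod q) := fun i₀ j =>
    Finset.univ.filter fun s => ¬ Representative τ θ x i₀ j s with hZ
  have hsub : badSeeds q ℓ τ θ x (Finset.univ.filter fun i => x i = x i₁).card ⊆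
      (Finset.univ.biUnion fun i₀ => (Finset.range ℓ).biUnion fun j => Z i₀ j ×ˢ {i₀}) ∪
        Finset.univ ×ˢ R := by
    rintro ⟨s, i₀⟩ hσ
    rw [badSeeds, Finset.mem_filter, hf] at hσ
    rw [Finset.mem_union]
    rcases hσ.2 with ⟨j, hj, h⟩ | h
    · left
      simp only [Finset.mem_biUnion, Finset.mem_univ, true_and, Finset.mem_range,
        Finset.mem_product, Finset.mem_singleton]
      exact ⟨i₀, j, hj, Finset.mem_filter.2 ⟨Finset.mem_univ _, h⟩, rfl⟩
    · right
      exact Finset.mem_product.2 ⟨Finset.mem_univ _, Finset.mem_filter.2 ⟨Finset.mem_univ _, h⟩⟩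
  have h1 : 32 * ((Finset.univ : Finset (Fin n)).biUnion fun i₀ =>
      (Finset.range ℓ).biUnion fun j => Z i₀ j ×ˢ {i₀}).card ≤ q ^ 2 * n := by
    have hin : ∀ i₀, 32 * ((Finset.range ℓ).biUnion fun j => Z i₀ j ×ˢ {i₀}).card ≤ q ^ 2 := by
      intro i₀
      rcases Nat.eq_zero_or_pos ℓ with rfl | hℓ
      · simp
      refine Nat.le_of_mul_le_mul_left (c := ℓ) ?_ hℓ
      calc ℓ * (32 * ((Finset.range ℓ).biUnion fun j => Z i₀ j ×ˢ {i₀}).card)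
          ≤ ℓ * (32 * ∑ j ∈ Finset.range ℓ, (Z i₀ j ×ˢ ({i₀} : Finset (Fin n))).card) := by
            gcongr
            exact Finset.card_biUnion_le
        _ = ∑ j ∈ Finset.range ℓ, 32 * ℓ * (Z i₀ j).card := by
            simp only [Finset.card_product, Finset.card_singleton, mul_one]
            rw [← Finset.mul_sum]; ring
        _ ≤ ∑ j ∈ Finset.range ℓ, q ^ 2 :=
            Finset.sum_le_sum fun j _ => card_not_representative_le hn hτ hθτ x i₀ j
        _ = ℓ * q ^ 2 := by simp
    calc _ ≤ 32 * ∑ i₀ : Fin n, ((Finset.range ℓ).biUnion fun j => Z i₀ j ×ˢ {i₀}).card :=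
          Nat.mul_le_mul_left _ Finset.card_biUnion_le
      _ ≤ ∑ i₀ : Fin n, q ^ 2 := by
          rw [Finset.mul_sum]
          exact Finset.sum_le_sum fun i₀ _ => hin i₀
      _ = q ^ 2 * n := by simp [mul_comm]
  have h2 : 32 * ((Finset.univ : Finset (ZMod q × ZMod q)) ×ˢ R).card ≤ q ^ 2 * n := by
    rw [Finset.card_product, Finset.card_univ, Fintype.card_prod, ZMod.card]
    have := card_bad_reference_le x i₁
    calc 32 * (q * q * R.card) = q ^ 2 * (32 * R.card) := by ring
      _ ≤ _ := Nat.mul_le_mul_left _ this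
  have h3 : Fintype.card (CopySeed q n) = q ^ 2 * n := by
    rw [Fintype.card_prod, Fintype.card_prod, ZMod.card, Fintype.card_fin, sq]
  have h4 := (Finset.card_le_card hsub).trans (Finset.card_union_le _ _)
  rw [h3]
  omega

/-- A minority of bad copies leaves the median accurate. -/
theorem abs_medianAnswer_sub_le {p : ℝ} (hp : 2 ≤ p) {n q ℓ τ d : ℕ} [Fact q.Prime] [NeZero q]
    [NeZero ℓ] (hn : n < q) (hτ : 0 < τ) (hnℓ : n ≤ 2 ^ (ℓ - 1)) (hd : 2 * (16 * τ) ≤ d)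
    {θ ε : ℝ} (hθ : 0 ≤ θ) (hθ1 : θ ≤ 1 / 4) (hε : p * (1 + 2 ^ (p - 1)) * (96 * θ) ≤ ε)
    (x : Fin n → ℤ) {i₁ : Fin n} (hi₁ : ∀ v, (Finset.univ.filter fun i => x i = v).card ≤
      (Finset.univ.filter fun i => x i = x i₁).card) (ω : Fin ℓ → CopySeed q n)
    (hω : 2 * (Finset.univ.filter fun c => ω c ∈
      badSeeds q ℓ τ θ x (Finset.univ.filter fun i => x i = x i₁).card).card < ℓ) :
    |medianAnswer p q n ℓ τ d (seedMatrix d ω) ((seedMatrix d ω).mulVec x) -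
      ((n : ℝ) ^ p - freqMoment p x)| ≤ ε * ((n : ℝ) ^ p - freqMoment p x) := by
  classical
  set F := (n : ℝ) ^ p - freqMoment p x with hF
  have hcount := card_eq_add_diffCount x i₁
  set f := (Finset.univ.filter fun i => x i = x i₁).card with hf
  have hmode := le_pow_sub_freqMoment hp x (f := f) (by omega) hi₁
  have hnf : (n : ℝ) - f = diffCount x i₁ := by
    rw [sub_eq_iff_eq_add']
    exact_mod_cast hcount.symm
  rw [hnf, ← hF] at hmode
  have hε0 : 0 ≤ ε := le_trans (by positivity) hε
  have hgood : ∀ c, ω c ∉ badSeeds q ℓ τ θ x f →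
      |copyAnswer p q ℓ (16 * τ) τ (fun j => blockOf ℓ d c (α := Fin n → ℤ) (seedMatrix d ω) j)
        (fun j => blockOf ℓ d c ((seedMatrix d ω).mulVec x) j) - F| ≤ ε * F := by
    intro c hc
    rw [badSeeds, Finset.mem_filter] at hc
    push Not at hc
    obtain ⟨h1, h2⟩ := hc (Finset.mem_univ _)
    refine (abs_copyAnswer_seed_le hp hn hτ hnℓ hd hθ hθ1 x ω c h1).trans ?_
    have h3 : (diffCount x (ω c).2 : ℝ) ≤ 32 * diffCount x i₁ := by
      have : diffCount x (ω c).2 ≤ 32 * diffCount x i₁ := by omega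
      exact_mod_cast this
    calc p * (1 + 2 ^ (p - 1)) * (3 * θ) * ((n : ℝ) ^ (p - 1) * diffCount x (ω c).2)
        ≤ p * (1 + 2 ^ (p - 1)) * (3 * θ) * ((n : ℝ) ^ (p - 1) * (32 * diffCount x i₁)) := by
          gcongr
      _ = p * (1 + 2 ^ (p - 1)) * (96 * θ) * ((n : ℝ) ^ (p - 1) * diffCount x i₁) := by ring
      _ ≤ ε * F := by gcongr
  have hmed := upperMedian_mem_Icc (fun c : Fin ℓ => copyAnswer p q ℓ (16 * τ) τ
    (fun j => blockOf ℓ d c (α := Fin n → ℤ) (seedMatrix d ω) j)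
    (fun j => blockOf ℓ d c ((seedMatrix d ω).mulVec x) j)) (lo := F - ε * F) (hi := F + ε * F)
    (by
      refine lt_of_le_of_lt (Nat.mul_le_mul_left 2 (Finset.card_le_card fun c hc => ?_)) hω
      refine Finset.mem_filter.2 ⟨Finset.mem_univ _, ?_⟩
      by_contra hcb
      have := abs_le.1 (hgood c hcb)
      exact (Finset.mem_filter.1 hc).2 ⟨by linarith [this.1], by linarith [this.2]⟩)
  rw [abs_le, medianAnswer]
  constructor <;> linarith [hmed.1, hmed.2]

/-! ### Choice of parameters and the resource bounds. -/

theorem two_lt_log_of_eight_le {y : ℝ} (hy : 8 ≤ y) : 2 < Real.log y := by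
  have h1 : Real.log 8 ≤ Real.log y := Real.log_le_log (by norm_num) hy
  have h2 : Real.log 8 = 3 * Real.log 2 := by
    rw [show (8 : ℝ) = 2 ^ 3 by norm_num, Real.log_pow]; norm_num
  linarith [Real.log_two_gt_d9]

theorem exp_half_le_two_pow {y : ℝ} {k : ℕ} (h : y ≤ k) : Real.exp (y / 2) ≤ 2 ^ k := by
  rw [← Real.exp_log (show (0 : ℝ) < 2 ^ k by positivity), Real.log_pow]
  apply Real.exp_le_exp.2
  have := Real.log_two_gt_d9
  have hk : (0 : ℝ) ≤ k := by positivity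
  nlinarith

/-- The sketch on vectors of positive length, for parameters that are large enough. -/
theorem exists_sketch {p : ℝ} (hp : 2 ≤ p) {n m M ℓ τ w : ℕ} (hn : 0 < n) (hℓ : 0 < ℓ) (hτ : 0 < τ)
    (hnℓ : n ≤ 2 ^ (ℓ - 1)) {θ ε δ : ℝ} (hθ : 0 ≤ θ) (hθ1 : θ ≤ 1 / 4)
    (hε : p * (1 + 2 ^ (p - 1)) * (96 * θ) ≤ ε) (hθτ : 64 * ℓ ≤ θ ^ 2 * τ) (hδ : 1 ≤ δ * 2 ^ ℓ)
    (hw1 : 4 * n ^ 2 < 2 ^ w) (hw2 : 16 + 4 * rowCount ℓ (32 * τ) < 2 ^ w)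
    (hw3 : 2 * n * (m * M) < 2 ^ (w - 1)) :
    ∃ A : LinearSketch n, A.words = 16 + 4 * rowCount ℓ (32 * τ) ∧ A.wordBits = w ∧
      A.MaintainedBy updateProgram (20 * rowCount ℓ (32 * τ) + 6) m M ∧
      ∀ x, A.Approximates x ((n : ℝ) ^ p - freqMoment p x) ε δ := by
  classical
  -- Bertrand's postulate: `q > n` separates the nodes `i + 1`, and `q ≤ 2 n` keeps the words short.
  obtain ⟨q, hq, hnq, hq2⟩ := Nat.exists_prime_lt_and_le_two_mul n hn.ne'
  have : Fact q.Prime := ⟨hq⟩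
  have : NeZero q := ⟨hq.ne_zero⟩
  have : NeZero ℓ := ⟨hℓ.ne'⟩
  have : NeZero n := ⟨hn.ne'⟩
  have hf : ∀ ω : Fin ℓ → CopySeed q n, Fits w q (rowCount ℓ (32 * τ))
      (fun r => (rowHash (32 * τ) ω r).1.val) (fun r => (rowHash (32 * τ) ω r).2.val)
      (rowThreshold q ℓ (32 * τ)) := fun ω => by
    refine ⟨hq.one_lt, fun r _ => ZMod.val_lt _, fun r _ => ZMod.val_lt _, fun r _ => ?_,
      lt_of_le_of_lt ?_ hw1, hw2⟩
    · unfold rowThreshold blockThreshold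
      split
      · exact Nat.div_le_self _ _
      · exact hq.one_lt.le
    · nlinarith
  refine ⟨sketch n w q (rowCount ℓ (32 * τ))
    (fun (ω : Fin ℓ → CopySeed q n) r => (rowHash (32 * τ) ω r).1.val)
    (fun ω r => (rowHash (32 * τ) ω r).2.val) (fun _ => rowThreshold q ℓ (32 * τ))
    (medianAnswer p q n ℓ τ (32 * τ)), rfl, rfl, sketch_maintained hf hnq.le ?_, fun x => ?_⟩
  · exact lt_of_le_of_lt (Nat.mul_le_mul_right _ hq2) hw3
  obtain ⟨i₁, hi₁⟩ := exists_mode x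
  set f := (Finset.univ.filter fun i => x i = x i₁).card with hfdef
  refine sketch_approximates hf x _ ε δ (Finset.univ.filter fun ω : Fin ℓ → CopySeed q n =>
    ℓ ≤ 2 * (Finset.univ.filter fun c => ω c ∈ badSeeds q ℓ τ θ x f).card) (fun ω hω => ?_) ?_
  · exact abs_medianAnswer_sub_le hp hnq hτ hnℓ (by omega) hθ hθ1 hε x hi₁ ω
      (by simpa using hω)
  · have h1 := card_majority_bad_le ℓ (badSeeds q ℓ τ θ x f)
      (card_badSeeds_le hnq.le hτ hθτ x i₁)
    set Z := Finset.univ.filter fun ω : Fin ℓ → CopySeed q n =>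
      ℓ ≤ 2 * (Finset.univ.filter fun c => ω c ∈ badSeeds q ℓ τ θ x f).card
    have h2 : (2 : ℝ) ^ ℓ * Z.card ≤ Fintype.card (Fin ℓ → CopySeed q n) := by exact_mod_cast h1
    have hδ0 : 0 < δ := by
      by_contra h
      have : δ * 2 ^ ℓ ≤ 0 := mul_nonpos_of_nonpos_of_nonneg (not_lt.1 h) (by positivity)
      linarith
    calc (Z.card : ℝ) ≤ δ * 2 ^ ℓ * Z.card := le_mul_of_one_le_left (by positivity) hδ
      _ = δ * (2 ^ ℓ * Z.card) := by ring
      _ ≤ _ := mul_le_mul_of_nonneg_left h2 hδ0.le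

/-- The trivial sketch of the empty vector. -/
theorem exists_sketch_zero {p : ℝ} (hp : p ≠ 0) (P : Prog) (m M : ℕ) {δ : ℝ} (hδ : 0 ≤ δ)
    (ε : ℝ) : ∃ A : LinearSketch 0, A.words = 0 ∧ A.wordBits = 0 ∧ A.MaintainedBy P 0 m M ∧
      ∀ x, A.Approximates x (((0 : ℕ) : ℝ) ^ p - freqMoment p x) ε δ := by
  refine ⟨{ dim := 0, words := 0, wordBits := 0, start := PMF.pure fun _ => 0, mat := fun _ => 0,
            cell := Function.Embedding.refl _, answer := fun _ _ => 0 }, rfl, rfl, ?_, fun x => ?_⟩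
  · intro μ₀ _ u _
    rcases u with _ | ⟨e, u⟩
    · exact ⟨μ₀, .nil _, rfl, fun l => l.elim0⟩
    · exact e.1.elim0
  · unfold LinearSketch.Approximates
    have h : freqMoment p x = 0 := by simp [freqMoment]
    have h0 : ((0 : ℕ) : ℝ) ^ p - freqMoment p x = 0 := by
      rw [h, Nat.cast_zero, Real.zero_rpow hp, sub_zero]
    rw [h0]
    refine (ENNReal.ofReal_le_one.2 (by linarith)).trans (le_of_eq ?_)
    symm
    rw [PMF.toOuterMeasure_apply_eq_one_iff]
    intro μ _
    simp

theorem mul_exp_pow_lt_two_pow {c L : ℝ} (hc : 1 < c) (hL : 1 < L) {k : ℕ}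
    (hk : 2 * (5 + Real.log c) * L ≤ k) : c * Real.exp L ^ 5 < 2 ^ k := by
  refine lt_of_lt_of_le ?_ (exp_half_le_two_pow hk)
  rw [show 2 * (5 + Real.log c) * L / 2 = Real.log c * L + 5 * L by ring, Real.exp_add,
    show Real.exp (5 * L) = Real.exp L ^ 5 by rw [← Real.exp_nat_mul]; norm_num]
  refine mul_lt_mul_of_pos_right ?_ (by positivity)
  nth_rewrite 1 [← Real.exp_log (show 0 < c by linarith)]
  exact Real.exp_lt_exp.2 (lt_mul_of_one_lt_right (Real.log_pos hc) hL)

/-- The memory size for the parameters of the sketch. -/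
theorem memory_le {K L E : ℝ} {ℓ τ : ℕ} (hK : 1 ≤ K) (hL : 2 ≤ L) (hE : 1 ≤ E)
    (hℓ1 : (1 : ℝ) ≤ ℓ) (hℓ : (ℓ : ℝ) ≤ 3 * L) (hτ : (τ : ℝ) ≤ 64 * K ^ 2 * ℓ * E + 1) :
    ((16 + 4 * rowCount ℓ (32 * τ) : ℕ) : ℝ) ≤
      (16 + 4 * (12 * 32 * 195 * K ^ 2)) * L ^ 3 * E := by
  have hbase : 1 ≤ K ^ 2 * ℓ * E :=
    one_le_mul_of_one_le_of_one_le (one_le_mul_of_one_le_of_one_le (one_le_pow₀ hK) hℓ1) hE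
  have hτ3 : (τ : ℝ) ≤ 195 * K ^ 2 * L * E :=
    calc (τ : ℝ) ≤ 64 * K ^ 2 * ℓ * E + 1 := hτ
      _ ≤ 65 * K ^ 2 * ℓ * E := by linarith
      _ ≤ 65 * K ^ 2 * (3 * L) * E := by gcongr
      _ = _ := by ring
  have h1 : ((rowCount ℓ (32 * τ) : ℕ) : ℝ) ≤ 12 * 32 * 195 * K ^ 2 * (L ^ 3 * E) := by
    rw [rowCount]
    push_cast
    calc (ℓ : ℝ) * ((ℓ + 1) * (32 * τ)) ≤
        (3 * L) * ((3 * L + L) * (32 * (195 * K ^ 2 * L * E))) := by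
          gcongr
          linarith
      _ = _ := by ring
  have h2 : 1 ≤ L ^ 3 * E := one_le_mul_of_one_le_of_one_le (one_le_pow₀ (by linarith)) hE
  push_cast
  linarith

theorem le_mul_add_two {x y z : ℝ} (hx : 0 ≤ x) (hy : 0 ≤ y) (hz : 0 ≤ z) :
    8 ≤ (x + 2) * (y + 2) * (z + 2) ∧ x ≤ (x + 2) * (y + 2) * (z + 2) ∧
      x * (y * z) ≤ (x + 2) * (y + 2) * (z + 2) := by
  have hxy := mul_nonneg hx hy
  have hyz := mul_nonneg hy hz
  have hxz := mul_nonneg hx hz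
  have hxyz := mul_nonneg hxy hz
  refine ⟨?_, ?_, ?_⟩ <;> linarith [show (x + 2) * (y + 2) * (z + 2) = x * y * z + 2 * (x * y) +
    2 * (y * z) + 2 * (x * z) + 4 * x + 4 * y + 4 * z + 8 by ring]

/-- For `p ≥ 2` the exponent `2 / (p - 1)` is at most 2, so addresses stay polynomial in `exp L`,
with a degree that does not depend on `p`. -/
theorem rpow_neg_le_sq {p γ X : ℝ} (hp : 2 ≤ p) (hγ : 0 < γ) (hγ1 : γ ≤ 1) (hX : γ⁻¹ ≤ X) :
    γ ^ (-(2 / (p - 1))) ≤ X ^ 2 := by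
  rw [Real.rpow_neg hγ.le, ← Real.inv_rpow hγ.le]
  have h1 : 1 ≤ γ⁻¹ := (one_le_inv₀ hγ).2 hγ1
  have h2 : 2 / (p - 1) ≤ (2 : ℕ) := by
    rw [div_le_iff₀ (by linarith)]; push_cast; linarith
  calc γ⁻¹ ^ (2 / (p - 1)) ≤ γ⁻¹ ^ ((2 : ℕ) : ℝ) := Real.rpow_le_rpow_of_exponent_le h1 h2
    _ = γ⁻¹ ^ 2 := Real.rpow_natCast _ _
    _ ≤ X ^ 2 := by gcongr

/-- The sketch, for all parameters. -/
theorem exists_linearSketch (p : ℝ) (hp : 2 ≤ p) :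
    ∃ (P : WordRAM.Prog) (C : ℝ) (k : ℕ),
      ∀ (n m M : ℕ) (γ δ : ℝ), 0 < γ → γ < 1 → 0 < δ → δ < 1 →
        ∀ L : ℝ, L = Real.log (((n : ℝ) + 2) * ((m : ℝ) + 2) * ((M : ℝ) + 2) / (γ * δ)) →
          ∃ (A : Turnstile.LinearSketch n) (T : ℕ),
            (A.wordBits : ℝ) ≤ C * L ∧
            (A.size : ℝ) ≤ C * L ^ k * γ ^ (-(2 / (p - 1))) ∧
            (T : ℝ) ≤ C * L ^ k * γ ^ (-(2 / (p - 1))) ∧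
            A.MaintainedBy P T m M ∧
            ∀ u : List (Fin n × ℤ), Turnstile.Valid m M u →
              A.Approximates (Turnstile.result u)
                ((n : ℝ) ^ p - Turnstile.freqMoment p (Turnstile.result u))
                (γ ^ (1 / (p - 1))) δ := by
  -- Here `96 = 3 * 32`: the tolerance factor at the chosen level times the loss from a random
  -- reference. With `θ = ε / K` the final relative error is exactly `ε`.
  set K : ℝ := 96 * (p * (1 + 2 ^ (p - 1))) with hK
  have hK4 : 4 ≤ K := by
    have : (0 : ℝ) < 2 ^ (p - 1) := by positivity
    nlinarith
  set C₀ : ℝ := 16 + 4 * (12 * 32 * 195 * K ^ 2) with hC₀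
  have hC₀1 : 16 ≤ C₀ := by rw [hC₀]; linarith [sq_nonneg K]
  set C₁ : ℝ := 2 * (5 + Real.log C₀) with hC₁
  have hlogC₀ : 0 < Real.log C₀ := Real.log_pos (by linarith)
  -- The three summands serve the size, the update time and the word length. The exponent 4 is `L^3`
  -- for the number of words times `L` for their length.
  refine ⟨updateProgram, C₀ * (C₁ + 1) + 5 * C₀ + (C₁ + 1), 4,
    fun n m M γ δ hγ hγ1 hδ hδ1 L hL => ?_⟩
  set E : ℝ := γ ^ (-(2 / (p - 1))) with hE
  have hγδ : 0 < γ * δ := mul_pos hγ hδ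
  have hγδ1 : γ * δ ≤ 1 := mul_le_one₀ hγ1.le hδ.le hδ1.le
  set N : ℝ := ((n : ℝ) + 2) * ((m : ℝ) + 2) * ((M : ℝ) + 2) with hN
  have hn0 : (0 : ℝ) ≤ n := by positivity
  have hm0 : (0 : ℝ) ≤ m := by positivity
  have hM0 : (0 : ℝ) ≤ M := by positivity
  obtain ⟨hN8, hNn, hNnmM⟩ := le_mul_add_two hn0 hm0 hM0
  rw [← hN] at hN8 hNn hNnmM
  have hNdiv : N ≤ N / (γ * δ) := le_div_self (by linarith) hγδ hγδ1
  have hL2 : 2 < L := hL ▸ two_lt_log_of_eight_le (hN8.trans hNdiv)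
  have hX : Real.exp L = N / (γ * δ) := by
    rw [hL, Real.exp_log (by linarith)]
  have hE1 : 1 ≤ E := Real.one_le_rpow_of_pos_of_le_one_of_nonpos hγ hγ1.le (by
    have : 0 ≤ 2 / (p - 1) := div_nonneg (by norm_num) (by linarith)
    linarith)
  -- For `n = 0` there is no reference coordinate to draw, so the seed space would be empty.
  rcases Nat.eq_zero_or_pos n with hn | hn
  · obtain ⟨A, hA1, hA2, hA3, hA4⟩ := exists_sketch_zero (p := p) (by linarith) updateProgram m M
      hδ.le (γ ^ (1 / (p - 1)))
    subst hn
    have hpos : 0 ≤ C₀ * (C₁ + 1) + 5 * C₀ + (C₁ + 1) := by positivity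
    refine ⟨A, 0, ?_, ?_, ?_, hA3, fun u _ => hA4 _⟩
    · rw [hA2, Nat.cast_zero]; positivity
    · rw [LinearSketch.size, hA1, zero_mul, Nat.cast_zero]; positivity
    · rw [Nat.cast_zero]; positivity
  set ε : ℝ := γ ^ (1 / (p - 1)) with hε
  have hε0 : 0 < ε := by positivity
  have hε1 : ε ≤ 1 := Real.rpow_le_one hγ.le hγ1.le (div_nonneg (by norm_num) (by linarith))
  have hεE : ε ^ 2 * E = 1 := by
    rw [hε, hE, ← Real.rpow_natCast, ← Real.rpow_mul hγ.le, ← Real.rpow_add hγ]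
    rw [show 1 / (p - 1) * ((2 : ℕ) : ℝ) + -(2 / (p - 1)) = 0 by push_cast; ring, Real.rpow_zero]
  -- This gives `2^(ℓ - 1) ≥ exp L`, which exceeds both `n`, as the levels require, and `1 / δ`, as
  -- the median requires.
  set ℓ : ℕ := ⌈2 * L⌉₊ + 1 with hℓ
  have hℓL : 2 * L ≤ (ℓ - 1 : ℕ) := Nat.le_ceil _
  have hℓ3 : (ℓ : ℝ) ≤ 3 * L := by
    have := Nat.ceil_lt_add_one (show 0 ≤ 2 * L by linarith)
    rw [hℓ]; push_cast; linarith
  set τ : ℕ := ⌈64 * K ^ 2 * ℓ * E⌉₊ with hτ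
  have hτle : 64 * K ^ 2 * ℓ * E ≤ τ := Nat.le_ceil _
  have hℓ1 : (1 : ℝ) ≤ ℓ := by rw [hℓ]; push_cast; linarith [Nat.cast_nonneg (α := ℝ) ⌈2 * L⌉₊]
  have hτ0 : 0 < τ := by
    have : (0 : ℝ) < τ := lt_of_lt_of_le (by positivity) hτle
    exact_mod_cast this
  have hD : ((16 + 4 * rowCount ℓ (32 * τ) : ℕ) : ℝ) ≤ C₀ * L ^ 3 * E :=
    memory_le (by linarith) hL2.le hE1 hℓ1 hℓ3 (Nat.ceil_lt_add_one (by positivity)).le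
  -- Makes `2^(w - 1)` exceed `C₀ * exp L ^ 5`, a common bound for products of residues, addresses
  -- and final counter values; the extra bit is the sign.
  set w : ℕ := ⌈C₁ * L⌉₊ + 1 with hw
  have hwL : C₁ * L ≤ (w - 1 : ℕ) := Nat.le_ceil _
  have hw3 : (w : ℝ) ≤ (C₁ + 1) * L := by
    have := Nat.ceil_lt_add_one (show 0 ≤ C₁ * L by positivity)
    rw [hw]; push_cast; linarith
  set X := Real.exp L with hXdef
  have hNX : N ≤ X := hX ▸ hNdiv
  have hX1 : 1 ≤ X := by linarith
  have hLX : L ≤ X := by linarith [Real.add_one_le_exp L]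
  have hγX : γ⁻¹ ≤ X := by
    rw [hX, inv_eq_one_div]
    exact div_le_div₀ (by linarith) (by linarith) hγδ (mul_le_of_le_one_right hγ.le hδ1.le)
  have hEX : E ≤ X ^ 2 := rpow_neg_le_sq hp hγ hγ1.le hγX
  have hbig : C₀ * X ^ 5 < 2 ^ (w - 1) :=
    mul_exp_pow_lt_two_pow (by linarith) (by linarith) hwL
  have hX5 : X ^ 2 ≤ X ^ 5 := pow_le_pow_right₀ hX1 (by norm_num)
  have hX15 : X ≤ X ^ 5 := le_self_pow₀ hX1 (by norm_num)
  have hww : (2 : ℕ) ^ (w - 1) ≤ 2 ^ w := Nat.pow_le_pow_right (by norm_num) (by omega)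
  have hnX : (n : ℝ) ≤ X := hNn.trans hNX
  have hX0 : 0 < X := by linarith
  obtain ⟨A, hA1, hA2, hA3, hA4⟩ := exists_sketch hp (m := m) (M := M) (ℓ := ℓ) (τ := τ) (w := w)
    (θ := ε / K) (ε := ε) (δ := δ) hn (by omega) hτ0
    (by
      have h1 := exp_half_le_two_pow hℓL
      rw [show 2 * L / 2 = L by ring] at h1
      exact_mod_cast hnX.trans h1)
    (by positivity)
    (by
      rw [div_le_iff₀ (by linarith)]
      linarith)
    (by
      apply le_of_eq
      rw [show p * (1 + 2 ^ (p - 1)) * (96 * (ε / K)) = K * (ε / K) by rw [hK]; ring]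
      field_simp)
    (by
      calc (64 : ℝ) * ℓ = (ε / K) ^ 2 * (64 * K ^ 2 * ℓ * E) := by
            rw [show (ε / K) ^ 2 * (64 * K ^ 2 * ℓ * E) = 64 * ℓ * (ε ^ 2 * E) * (K / K) ^ 2 by ring,
              hεE, div_self (by linarith)]
            ring
        _ ≤ _ := by gcongr)
    (by
      have h1 := exp_half_le_two_pow hℓL
      rw [show 2 * L / 2 = L by ring] at h1
      have h2 : (2 : ℝ) ^ (ℓ - 1) ≤ 2 ^ ℓ := pow_le_pow_right₀ (by norm_num) (by omega)
      have h3 : 1 ≤ δ * X := by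
        rw [hX, mul_div_assoc', le_div_iff₀ hγδ, one_mul]
        calc γ * δ ≤ δ := mul_le_of_le_one_left hδ.le hγ1.le
          _ ≤ δ * N := le_mul_of_one_le_right hδ.le (by linarith)
      refine h3.trans (mul_le_mul_of_nonneg_left (h1.trans h2) hδ.le))
    (by
      refine lt_of_lt_of_le ?_ hww
      have : ((4 * n ^ 2 : ℕ) : ℝ) < ((2 ^ (w - 1) : ℕ) : ℝ) := by
        push_cast
        refine lt_of_le_of_lt ?_ hbig
        calc 4 * (n : ℝ) ^ 2 ≤ C₀ * X ^ 2 := by gcongr; linarith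
          _ ≤ C₀ * X ^ 5 := by gcongr
      exact_mod_cast this)
    (by
      refine lt_of_lt_of_le ?_ hww
      have : ((16 + 4 * rowCount ℓ (32 * τ) : ℕ) : ℝ) < ((2 ^ (w - 1) : ℕ) : ℝ) := by
        refine hD.trans_lt ?_
        push_cast
        refine lt_of_le_of_lt ?_ hbig
        calc C₀ * L ^ 3 * E ≤ C₀ * X ^ 3 * X ^ 2 := by gcongr
          _ = _ := by ring
      exact_mod_cast this)
    (by
      have : ((2 * n * (m * M) : ℕ) : ℝ) < ((2 ^ (w - 1) : ℕ) : ℝ) := by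
        push_cast
        refine lt_of_le_of_lt ?_ hbig
        calc 2 * (n : ℝ) * (m * M) = 2 * (n * (m * M)) := by ring
          _ ≤ C₀ * X := by
            refine mul_le_mul (by linarith) (hNnmM.trans hNX) (by positivity) (by linarith)
          _ ≤ C₀ * X ^ 5 := by gcongr
      exact_mod_cast this)
  have hL34 : L ^ 3 * E ≤ L ^ 4 * E := by
    gcongr
    · linarith
    · norm_num
  refine ⟨A, 20 * rowCount ℓ (32 * τ) + 6, ?_, ?_, ?_, hA3, fun u _ => hA4 _⟩
  · rw [hA2]
    refine hw3.trans (mul_le_mul_of_nonneg_right ?_ (by linarith))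
    have : 0 ≤ C₀ * (C₁ + 1) + 5 * C₀ := by positivity
    linarith
  · rw [LinearSketch.size, hA1, hA2, Nat.cast_mul]
    calc ((16 + 4 * rowCount ℓ (32 * τ) : ℕ) : ℝ) * w ≤ C₀ * L ^ 3 * E * ((C₁ + 1) * L) := by gcongr
      _ = C₀ * (C₁ + 1) * L ^ 4 * E := by ring
      _ ≤ _ := by
        gcongr
        have : 0 ≤ 5 * C₀ + (C₁ + 1) := by positivity
        linarith
  · have h1 : ((20 * rowCount ℓ (32 * τ) + 6 : ℕ) : ℝ) ≤
        5 * ((16 + 4 * rowCount ℓ (32 * τ) : ℕ) : ℝ) := by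
      push_cast; linarith
    calc _ ≤ 5 * (C₀ * L ^ 3 * E) := h1.trans (by gcongr)
      _ = 5 * C₀ * (L ^ 3 * E) := by ring
      _ ≤ 5 * C₀ * (L ^ 4 * E) := by gcongr
      _ = 5 * C₀ * L ^ 4 * E := by ring
      _ ≤ _ := by
        gcongr
        have : 0 ≤ C₀ * (C₁ + 1) + (C₁ + 1) := by positivity
        linarith

end TurnstileSketch

theorem mainTheorem3 (p : ℝ) (hp : 2 ≤ p) :
    ∃ (P : WordRAM.Prog) (C : ℝ) (k : ℕ),
      ∀ (n m M : ℕ) (γ δ : ℝ), 0 < γ → γ < 1 → 0 < δ → δ < 1 →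
        ∀ L : ℝ, L = Real.log (((n : ℝ) + 2) * ((m : ℝ) + 2) * ((M : ℝ) + 2) / (γ * δ)) →
          ∃ (A : Turnstile.LinearSketch n) (T : ℕ),
            (A.wordBits : ℝ) ≤ C * L ∧
            (A.size : ℝ) ≤ C * L ^ k * γ ^ (-(2 / (p - 1))) ∧
            (T : ℝ) ≤ C * L ^ k * γ ^ (-(2 / (p - 1))) ∧
            A.MaintainedBy P T m M ∧
            ∀ u : List (Fin n × ℤ), Turnstile.Valid m M u →
              A.Approximates (Turnstile.result u)
                ((n : ℝ) ^ p - Turnstile.freqMoment p (Turnstile.result u))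
                (γ ^ (1 / (p - 1))) δ :=
  TurnstileSketch.exists_linearSketch p hp
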